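/- Let $k$ be an algebraically closed field of characteristic zero and let $\mathcal C$ be a modular tensor category over $k$. That is: $\mathcal C$ is $k$-linear abelian and equivalent, as a $k$-linear category, to the category of finite-dimensional modules over some finite-dimensional $k$-algebra; it is a rigid monoidal category with $k$-bilinear tensor product and simple unit $\mathbf 1$; it has a braiding $\beta$ and a twist $\theta$ making it a ribbon category; and the pairing $\omega$ defined below is non-degenerate. (Associativity and unit isomorphisms are suppressed from the notation.) Let $L=\int^{X\in\mathcal C}X^*\otimes X$ be the canonical coend (it exists), with universal dinatural transformation $\iota_X\colon X^*\otimes X\to L$. Define $\omega\colon L\otimes L\to\mathbf 1$ and $\mu\colon L\otimes L\to L$ as the unique morphisms with $$\omega\circ(\iota_X\otimes\iota_Y)=(\mathrm{ev}_X\otimes\mathrm{ev}_Y)\circ(\mathrm{id}_{X^*}\otimes(\beta_{Y^*,X}\circ\beta_{X,Y^*})\otimes\mathrm{id}_Y),$$ $$\mu\circ(\iota_X\otimes\iota_Y)=\iota_{X\otimes Y}\circ(\beta_{X^*\otimes X,\,Y^*}\otimes\mathrm{id}_Y)$$ for all $X,Y\in\mathcal C$, where $Y^*\otimes X^*$ is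 identified with $(X\otimes Y)^*$ canonically. Non-degeneracy of $\omega$ means that there is a morphism $\mathbf 1\to L\otimes L$ which together with $\omega$ makes $L$ a dual of itself. For $D\in\mathcal C$ let $$\widetilde{\mathrm{coev}}_D=(\mathrm{id}_{D^*}\otimes\theta_D)\circ\beta_{D,D^*}\circ\mathrm{coev}_D\colon\mathbf 1\to D^*\otimes D$$ be the second coevaluation of the pivotal structure determined by $\theta$, let $\check\chi_D=\iota_D\circ\widetilde{\mathrm{coev}}_D\colon\mathbf 1\to L$ be the internal cocharacter of $D$, and let $$\mathcal O_D=\mu\circ(\check\chi_D\otimes\mathrm{id}_L)\colon L\to L$$ be the defect operator of $D$. Let $\mathrm{End}_L(L)$ be the $k$-algebra (under composition) of those endomorphisms $f$ of $L$ in $\mathcal C$ which are right $L$-module maps, i.e. $f\circ\mu=\mu\circ(f\otimes\mathrm{id}_L)$. Let $\mathrm{Gr}_k(\mathcal C)=k\otimes_{\mathbb Z}\mathrm{Gr}(\mathcal C)$ be the linearised Grothendieck ring: $\mathrm{Gr}(\mathcal C)$ is generated as an abelian group by the classes $[X]$ of the objects, with relations $[X_2]=[X_1]+[X_3]$ for short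 exact sequences $0\to X_1\to X_2\to X_3\to0$, and has product $[X][Y]=[X\otimes Y]$. Proposition 5.1. Every defect operator $\mathcal O_D$ lies in $\mathrm{End}_L(L)$, and the $k$-subalgebra of $\mathrm{End}_L(L)$ generated by all $\mathcal O_D$, $D\in\mathcal C$, is isomorphic as a $k$-algebra to $\mathrm{Gr}_k(\mathcal C)$, by an isomorphism that sends $\mathcal O_D$ to $1\otimes[D]$ for every $D\in\mathcal C$. -/

import Mathlib

open CategoryTheory MonoidalCategory Limits Opposite
universe w v u

namespace ModularTensor

/-- A `k`-linear category is *finite* if it is equivalent, as a `k`-linear category, to the category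
of finitely generated (equivalently, finite-dimensional) modules over a finite-dimensional
`k`-algebra `A`. The algebra may be taken in the universe of the morphism spaces. -/
class IsFiniteLinear (k : Type w) [Field k] (C : Type u) [Category.{v} C] [Preadditive C]
    [Linear k C] : Prop where
  exists_equivalence : ∃ (A : Type v) (_ : Ring A) (_ : Algebra k A), Module.Finite k A ∧
    ∃ e : C ≌ FGModuleCat.{v} A, e.functor.Additive ∧ e.functor.Linear k

section FG
variable {A : Type v} [Ring A]

theorem fg_surjective {M N : FGModuleCat.{v} A} (f : M ⟶ N) [Epi f] :
    Function.Surjective f.hom.hom := by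
  rw [← LinearMap.range_eq_top]
  let q : N ⟶ FGModuleCat.of A (N ⧸ LinearMap.range f.hom.hom) :=
    FGModuleCat.ofHom (LinearMap.range f.hom.hom).mkQ
  let z : N ⟶ FGModuleCat.of A (N ⧸ LinearMap.range f.hom.hom) := FGModuleCat.ofHom 0
  have h : f ≫ q = f ≫ z := by
    ext x
    exact (Submodule.Quotient.mk_eq_zero _).2 ⟨x, rfl⟩
  have h2 : q = z := (cancel_epi f).1 h
  rw [eq_top_iff]
  rintro x -
  have := congrArg (fun g => g.hom.hom x) h2
  exact (Submodule.Quotient.mk_eq_zero _).1 this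

theorem fg_projective : Projective (FGModuleCat.of A A) where
  factors {E X} f e _ := by
    obtain ⟨y, hy⟩ := fg_surjective e (f.hom.hom (1 : A))
    refine ⟨FGModuleCat.ofHom (LinearMap.toSpanSingleton A E y), ?_⟩
    ext
    change e.hom.hom ((LinearMap.toSpanSingleton A E y) 1) = _
    simpa using hy

theorem fg_generates (M : FGModuleCat.{v} A) : ∃ (n : ℕ) (p : Fin n → (FGModuleCat.of A A ⟶ M)),
    ∀ (N : FGModuleCat.{v} A) (f g : M ⟶ N), (∀ i, p i ≫ f = p i ≫ g) → f = g := by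
  obtain ⟨n, s, hs⟩ := Module.Finite.exists_fin (R := A) (M := M)
  refine ⟨n, fun i => FGModuleCat.ofHom (LinearMap.toSpanSingleton A M (s i)), fun N f g h => ?_⟩
  ext1
  refine LinearMap.ext_on_range (v := s) hs fun i => ?_
  have := congrArg (fun g => g.hom.hom (1 : A)) (h i)
  change f.hom.hom (LinearMap.toSpanSingleton A M (s i) 1) =
    g.hom.hom (LinearMap.toSpanSingleton A M (s i) 1) at this
  simpa using this

end FG

theorem finite_hom (k : Type w) [Field k] {C : Type u} [Category.{v} C] [Preadditive C]
    [Linear k C] [IsFiniteLinear k C] (X Y : C) : Module.Finite k (X ⟶ Y) := by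
  obtain ⟨A, _, _, hA, e, _, hl⟩ := IsFiniteLinear.exists_equivalence (k := k) (C := C)
  obtain ⟨n, s, hs⟩ := Module.Finite.exists_fin (R := A) (M := e.functor.obj X)
  let : Module k (e.functor.obj Y) := Module.compHom _ (algebraMap k A)
  have : IsScalarTower k A (e.functor.obj Y) := IsScalarTower.of_algebraMap_smul fun _ _ => rfl
  have : Module.Finite k (e.functor.obj Y) := Module.Finite.trans A _
  let φ : (X ⟶ Y) →ₗ[k] (Fin n → e.functor.obj Y) :=
    { toFun := fun f i => (e.functor.map f).hom.hom (s i)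
      map_add' := fun f g => by
        funext i
        rw [Functor.map_add]; rfl
      map_smul' := fun c f => by
        funext i
        rw [Functor.map_smul]; rfl }
  refine Module.Finite.of_injective φ fun f g h => e.functor.map_injective ?_
  ext1
  exact LinearMap.ext_on_range (v := s) hs fun i => congrFun h i

theorem exists_progenerator (k : Type w) [Field k] (C : Type u) [Category.{v} C] [Preadditive C]
    [Linear k C] [IsFiniteLinear k C] : ∃ P : C, Projective P ∧ ∀ X : C, ∃ (n : ℕ) (p : Fin n → (P ⟶ X)),
    ∀ (Y : C) (f g : X ⟶ Y), (∀ i, p i ≫ f = p i ≫ g) → f = g := by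
  obtain ⟨A, _, _, hA, e, _, _⟩ := IsFiniteLinear.exists_equivalence (k := k) (C := C)
  refine ⟨e.inverse.obj (FGModuleCat.of A A), ?_, fun X => ?_⟩
  · exact (e.symm.map_projective_iff _).2 fg_projective
  · obtain ⟨n, p, hp⟩ := fg_generates (e.functor.obj X)
    refine ⟨n, fun i => e.inverse.map (p i) ≫ (e.unitIso.app X).inv, fun Y f g h => ?_⟩
    apply e.functor.map_injective
    apply hp
    intro i
    have := h i
    have h2 := congrArg (· ≫ e.unit.app Y) this
    apply e.inverse.map_injective
    simpa only [Functor.map_comp, Equivalence.inv_fun_map, Category.assoc, Iso.app_inv] using h2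


section InnerHom
variable (C : Type u) [Category.{v} C] [MonoidalCategory C] [RigidCategory C]

/-- The inner hom functor `(X, Y) ↦ X* ⊗ Y`. The dual `X*` is `Xᘁ`, with evaluation
`ε_ X Xᘁ : X* ⊗ X ⟶ 𝟙` and coevaluation `η_ X Xᘁ : 𝟙 ⟶ X ⊗ X*`. -/
@[simps]
def innerHom : Cᵒᵖ ⥤ C ⥤ C where
  obj X := tensorLeft (X.unopᘁ)
  map f := (curriedTensor C).map (f.unopᘁ)
  map_id X := by ext; simp
  map_comp f g := by ext; simp [comp_rightAdjointMate]

end InnerHom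

theorem rightMate_add {C : Type u} [Category.{v} C] [Preadditive C] [MonoidalCategory C]
    [MonoidalPreadditive C] {X Y : C} [HasRightDual X] [HasRightDual Y] (f g : X ⟶ Y) :
    (f + g)ᘁ = fᘁ + gᘁ := by
  simp [rightAdjointMate]

theorem rightMate_smul (k : Type w) [Field k] {C : Type u} [Category.{v} C] [Preadditive C]
    [Linear k C] [MonoidalCategory C]
    [MonoidalPreadditive C] [MonoidalLinear k C] {X Y : C} [HasRightDual X] [HasRightDual Y]
    (c : k) (f : X ⟶ Y) :
    (c • f)ᘁ = c • fᘁ := by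
  simp [rightAdjointMate]

theorem rightMate_sum {C : Type u} [Category.{v} C] [Preadditive C] [MonoidalCategory C]
    [MonoidalPreadditive C] {X Y : C} [HasRightDual X] [HasRightDual Y] {n : ℕ}
    (f : Fin n → (X ⟶ Y)) :
    (∑ i, f i)ᘁ = ∑ i, (f i)ᘁ :=
  map_sum (AddMonoidHom.mk' (fun f : X ⟶ Y => fᘁ) rightMate_add) f _

section Existence

variable {C : Type u} [Category.{v} C] [Abelian C] [MonoidalCategory C] [MonoidalPreadditive C]
  [RigidCategory C]

theorem exists_extension {P L : C} [Projective P]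
    (hP : ∀ X : C, ∃ (n : ℕ) (p : Fin n → (P ⟶ X)),
      ∀ (Y : C) (f g : X ⟶ Y), (∀ i, p i ≫ f = p i ≫ g) → f = g)
    (q : Pᘁ ⊗ P ⟶ L) (hq : ∀ h : P ⟶ P, hᘁ ▷ P ≫ q = Pᘁ ◁ h ≫ q) (X : C) :
    ∃ t : Xᘁ ⊗ X ⟶ L, ∀ g : P ⟶ X, Xᘁ ◁ g ≫ t = gᘁ ▷ P ≫ q := by
  obtain ⟨n, p, hp⟩ := hP X
  have := Abelian.hasFiniteBiproducts (C := C)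
  let Q : C := ⨁ fun _ : Fin n => P
  let π : Q ⟶ X := biproduct.desc p
  have hπi : ∀ i, biproduct.ι (fun _ : Fin n => P) i ≫ π = p i := fun i => by simp [π]
  have hπ : Epi π := ⟨fun f g h => hp _ f g fun i => by
    rw [← hπi, Category.assoc, h, Category.assoc]⟩
  let m : Xᘁ ⊗ Q ⟶ L := ∑ i, (HasRightDual.rightDual X) ◁ biproduct.π (fun _ : Fin n => P) i ≫ (p i)ᘁ ▷ P ≫ q
  have key : ∀ s : P ⟶ Q, Xᘁ ◁ s ≫ m = (s ≫ π)ᘁ ▷ P ≫ q := by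
    intro s
    have hs : s ≫ π = ∑ i, (s ≫ biproduct.π (fun _ : Fin n => P) i) ≫ p i := by
      have h1 : π = ∑ i, biproduct.π (fun _ : Fin n => P) i ≫ p i := by
        ext j
        simp [π, Preadditive.comp_sum, biproduct.ι_π_assoc, ite_comp]
      conv_lhs => rw [h1, Preadditive.comp_sum]
      simp
    rw [hs, rightMate_sum, sum_whiskerRight, Preadditive.sum_comp, Preadditive.comp_sum]
    refine Finset.sum_congr rfl fun i _ => ?_
    rw [comp_rightAdjointMate, comp_whiskerRight, Category.assoc, hq, ← whisker_exchange_assoc,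
      ← whiskerLeft_comp_assoc]
  have hm : kernel.ι π ≫ tensorLeftHomEquiv Q X Xᘁ L m = 0 := by
    obtain ⟨n', p', hp'⟩ := hP (kernel π)
    refine hp' _ _ _ fun j => ?_
    apply (tensorLeftHomEquiv P X (HasRightDual.rightDual X) L).symm.injective
    rw [← Category.assoc, tensorLeftHomEquiv_symm_naturality, Equiv.symm_apply_apply, key,
      Category.assoc, kernel.condition, comp_zero, comp_zero]
    simp [rightAdjointMate, tensorLeftHomEquiv]
  let t' : X ⟶ X ⊗ L := Abelian.epiDesc π _ hm
  refine ⟨(tensorLeftHomEquiv X X Xᘁ L).symm t', fun g => ?_⟩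
  have h1 : Xᘁ ◁ π ≫ (tensorLeftHomEquiv X X Xᘁ L).symm t' = m := by
    rw [← tensorLeftHomEquiv_symm_naturality]
    simp [t']
  obtain ⟨s, hs⟩ : ∃ s : P ⟶ Q, s ≫ π = g := ⟨Projective.factorThru g π, by simp⟩
  rw [← hs, ← key, ← h1]
  simp

theorem hasCoend_of_generator {P L : C} [Projective P]
    (hP : ∀ X : C, ∃ (n : ℕ) (p : Fin n → (P ⟶ X)),
      ∀ (Y : C) (f g : X ⟶ Y), (∀ i, p i ≫ f = p i ≫ g) → f = g)
    (q : Pᘁ ⊗ P ⟶ L) (hq : ∀ h : P ⟶ P, hᘁ ▷ P ≫ q = Pᘁ ◁ h ≫ q) 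
    (desc : ∀ {Z : C} (r : Pᘁ ⊗ P ⟶ Z), (∀ h : P ⟶ P, hᘁ ▷ P ≫ r = Pᘁ ◁ h ≫ r) → (L ⟶ Z))
    (fac : ∀ {Z : C} (r : Pᘁ ⊗ P ⟶ Z) (hr : ∀ h : P ⟶ P, hᘁ ▷ P ≫ r = Pᘁ ◁ h ≫ r),
      q ≫ desc r hr = r) [Epi q] : HasCoend (innerHom C) := by
  have hP' : ∀ (X W Z : C) (f g : Xᘁ ⊗ W ⟶ Z), (∀ s : P ⟶ W, Xᘁ ◁ s ≫ f = Xᘁ ◁ s ≫ g) → f = g := by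
    intro X W Z f g h
    obtain ⟨n, p, hp⟩ := hP W
    apply (tensorLeftHomEquiv W X Xᘁ Z).injective
    refine hp _ _ _ fun i => (tensorLeftHomEquiv P X Xᘁ Z).symm.injective ?_
    simp only [tensorLeftHomEquiv_symm_naturality, Equiv.symm_apply_apply, h]
  choose t ht using exists_extension hP q hq
  have hdin : ∀ ⦃X Y : C⦄ (f : X ⟶ Y), fᘁ ▷ X ≫ t X = Yᘁ ◁ f ≫ t Y := by
    intro X Y f
    refine hP' _ _ _ _ _ fun s => ?_
    rw [whisker_exchange_assoc, ht, ← whiskerLeft_comp_assoc, ht, comp_rightAdjointMate,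
      comp_whiskerRight, Category.assoc]
  have htP : t P = q := by simpa using ht P (𝟙 P)
  let c : Cowedge (innerHom C) := Cowedge.mk L t (fun X Y f => hdin f)
  have hfac {Z : C} (r : ∀ X : C, Xᘁ ⊗ X ⟶ Z)
      (hr : ∀ ⦃X Y : C⦄ (f : X ⟶ Y), fᘁ ▷ X ≫ r X = Yᘁ ◁ f ≫ r Y) (X : C) :
      t X ≫ desc (r P) (fun h => hr h) = r X := by
    refine hP' _ _ _ _ _ fun g => ?_
    rw [← Category.assoc, ht, Category.assoc, fac, hr]
  have huniq {Z : C} (r : ∀ X : C, Xᘁ ⊗ X ⟶ Z)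
      (hr : ∀ ⦃X Y : C⦄ (f : X ⟶ Y), fᘁ ▷ X ≫ r X = Yᘁ ◁ f ≫ r Y) (m : L ⟶ Z)
      (hm : ∀ X, t X ≫ m = r X) : m = desc (r P) (fun h => hr h) := by
    rw [← cancel_epi q, fac, ← hm P, htP]
  have hc : IsColimit c := Multicofork.IsColimit.mk _
    (fun s => desc (s.π P) (fun h => Cowedge.condition (F := innerHom C) s h))
    (fun s => hfac (fun X => s.π X) (fun X Y f => Cowedge.condition (F := innerHom C) s f))
    (fun s => huniq (fun X => s.π X) (fun X Y f => Cowedge.condition (F := innerHom C) s f))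
  exact ⟨⟨c, hc⟩⟩

theorem hasCoend_innerHom (k : Type w) [Field k] (C : Type u) [Category.{v} C] [Abelian C]
    [Linear k C] [IsFiniteLinear k C] [MonoidalCategory C] [MonoidalPreadditive C]
    [MonoidalLinear k C] [RigidCategory C] : HasCoend (innerHom C) := by
  have := Abelian.hasFiniteBiproducts (C := C)
  obtain ⟨P, _, hP⟩ := exists_progenerator k C
  have := finite_hom k P P
  obtain ⟨n, s, hs⟩ := Module.Finite.exists_fin (R := k) (M := (P ⟶ P))
  let d : (⨁ fun _ : Fin n => Pᘁ ⊗ P) ⟶ Pᘁ ⊗ P :=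
    biproduct.desc fun i => (s i)ᘁ ▷ P - Pᘁ ◁ (s i)
  have hd : ∀ {Z : C} (r : Pᘁ ⊗ P ⟶ Z), d ≫ r = 0 ↔ ∀ h : P ⟶ P, hᘁ ▷ P ≫ r = Pᘁ ◁ h ≫ r := by
    intro Z r
    constructor
    · intro h0 h
      have hh : h ∈ Submodule.span k (Set.range s) := hs ▸ Submodule.mem_top
      induction hh using Submodule.span_induction with
      | mem x hx =>
        obtain ⟨i, rfl⟩ := hx
        have := congrArg (biproduct.ι (fun _ : Fin n => Pᘁ ⊗ P) i ≫ ·) h0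
        simpa [d, sub_eq_zero] using this
      | zero => simp [rightAdjointMate]
      | add x y _ _ hx hy => simp [rightMate_add, hx, hy]
      | smul c x _ hx => simp [rightMate_smul k, hx]
    · intro h
      ext i
      simp [d, h]
  exact hasCoend_of_generator hP (cokernel.π d) ((hd _).1 (cokernel.condition d))
    (fun r hr => cokernel.desc d r ((hd r).2 hr)) (fun r hr => cokernel.π_desc _ _ _)

end Existence

/-- A ribbon structure on a braided rigid category: a natural automorphism `θ` of the identity
functor (the twist) with `θ_{X ⊗ Y} = β_{Y,X} ∘ β_{X,Y} ∘ (θ_X ⊗ θ_Y)` and `θ_{X*} = (θ_X)*`. -/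
class RibbonCategory (C : Type u) [Category.{v} C] [MonoidalCategory C] [BraidedCategory C]
    [RigidCategory C] where
  /-- The component of the twist at `X`. -/
  twist (X : C) : X ≅ X
  twist_naturality {X Y : C} (f : X ⟶ Y) : f ≫ (twist Y).hom = (twist X).hom ≫ f
  twist_tensor (X Y : C) : (twist (X ⊗ Y)).hom =
    ((twist X).hom ⊗ₘ (twist Y).hom) ≫ (β_ X Y).hom ≫ (β_ Y X).hom
  twist_dual (X : C) : (twist Xᘁ).hom = (twist X).homᘁ

section Coend

variable {C : Type u} [Category.{v} C] [MonoidalCategory C] [RigidCategory C]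
  [HasCoend (innerHom C)]

variable (C) in
/-- The canonical coend `L = ∫^X X* ⊗ X`. -/
noncomputable def canonicalCoend : C := coend (innerHom C)

/-- The universal dinatural transformation `ι_X : X* ⊗ X ⟶ L`. -/
noncomputable def dinat (X : C) : Xᘁ ⊗ X ⟶ canonicalCoend C := coend.ι (innerHom C) X

theorem dinat_condition {X Y : C} (f : X ⟶ Y) : fᘁ ▷ X ≫ dinat X = Yᘁ ◁ f ≫ dinat Y :=
  coend.condition (innerHom C) f

/-- The morphism out of `L` induced by a dinatural family. -/
noncomputable def coendDesc {Z : C} (φ : ∀ X : C, Xᘁ ⊗ X ⟶ Z)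
    (hφ : ∀ ⦃X Y : C⦄ (f : X ⟶ Y), fᘁ ▷ X ≫ φ X = Yᘁ ◁ f ≫ φ Y) : canonicalCoend C ⟶ Z :=
  coend.desc (F := innerHom C) φ hφ

theorem dinat_coendDesc {Z : C} (φ : ∀ X : C, Xᘁ ⊗ X ⟶ Z)
    (hφ : ∀ ⦃X Y : C⦄ (f : X ⟶ Y), fᘁ ▷ X ≫ φ X = Yᘁ ◁ f ≫ φ Y) (X : C) :
    dinat X ≫ coendDesc φ hφ = φ X :=
  coend.ι_desc (F := innerHom C) φ hφ X

theorem canonicalCoend_hom_ext {Z : C} {f g : canonicalCoend C ⟶ Z}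
    (h : ∀ X : C, dinat X ≫ f = dinat X ≫ g) : f = g :=
  coend.hom_ext (F := innerHom C) h

/-- The morphism `L ⊗ V ⟶ Z` induced by a dinatural family `(X* ⊗ X) ⊗ V ⟶ Z`. -/
noncomputable def descLeft {V Z : C} (φ : ∀ X : C, (Xᘁ ⊗ X) ⊗ V ⟶ Z)
    (hφ : ∀ ⦃X Y : C⦄ (f : X ⟶ Y), (fᘁ ▷ X) ▷ V ≫ φ X = (Yᘁ ◁ f) ▷ V ≫ φ Y) :
    canonicalCoend C ⊗ V ⟶ Z :=
  (tensorRightHomEquiv (canonicalCoend C) V Vᘁ Z).symm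
    (coendDesc (fun X => tensorRightHomEquiv (Xᘁ ⊗ X) V Vᘁ Z (φ X)) fun X Y f => by
      apply (tensorRightHomEquiv (Yᘁ ⊗ X) V (HasRightDual.rightDual V) Z).symm.injective
      simpa only [tensorRightHomEquiv_symm_naturality, Equiv.symm_apply_apply] using hφ f)

/-- The morphism `V ⊗ L ⟶ Z` induced by a dinatural family `V ⊗ (Y* ⊗ Y) ⟶ Z`. -/
noncomputable def descRight {V Z : C} (φ : ∀ Y : C, V ⊗ (Yᘁ ⊗ Y) ⟶ Z)
    (hφ : ∀ ⦃X Y : C⦄ (f : X ⟶ Y), V ◁ (fᘁ ▷ X) ≫ φ X = V ◁ (Yᘁ ◁ f) ≫ φ Y) :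
    V ⊗ canonicalCoend C ⟶ Z :=
  (tensorLeftHomEquiv (canonicalCoend C) (ᘁV) V Z).symm
    (coendDesc (fun X => tensorLeftHomEquiv (Xᘁ ⊗ X) (ᘁV) V Z (φ X)) fun X Y f => by
      apply (tensorLeftHomEquiv (Yᘁ ⊗ X) (HasLeftDual.leftDual V) V Z).symm.injective
      simpa only [tensorLeftHomEquiv_symm_naturality, Equiv.symm_apply_apply] using hφ f)

theorem dinat_descLeft {V Z : C} (φ : ∀ X : C, (Xᘁ ⊗ X) ⊗ V ⟶ Z)
    (hφ : ∀ ⦃X Y : C⦄ (f : X ⟶ Y), (fᘁ ▷ X) ▷ V ≫ φ X = (Yᘁ ◁ f) ▷ V ≫ φ Y) (X : C) :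
    dinat X ▷ V ≫ descLeft φ hφ = φ X := by
  rw [descLeft, ← tensorRightHomEquiv_symm_naturality, dinat_coendDesc, Equiv.symm_apply_apply]

theorem dinat_descRight {V Z : C} (φ : ∀ Y : C, V ⊗ (Yᘁ ⊗ Y) ⟶ Z)
    (hφ : ∀ ⦃X Y : C⦄ (f : X ⟶ Y), V ◁ (fᘁ ▷ X) ≫ φ X = V ◁ (Yᘁ ◁ f) ≫ φ Y) (X : C) :
    V ◁ dinat X ≫ descRight φ hφ = φ X := by
  rw [descRight, ← tensorLeftHomEquiv_symm_naturality, dinat_coendDesc, Equiv.symm_apply_apply]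

theorem descRight_ext {V Z : C} {f g : V ⊗ canonicalCoend C ⟶ Z}
    (h : ∀ X : C, V ◁ dinat X ≫ f = V ◁ dinat X ≫ g) : f = g := by
  apply (tensorLeftHomEquiv (canonicalCoend C) (HasLeftDual.leftDual V) V Z).injective
  refine canonicalCoend_hom_ext fun X => ?_
  apply (tensorLeftHomEquiv (Xᘁ ⊗ X) (HasLeftDual.leftDual V) V Z).symm.injective
  simpa only [tensorLeftHomEquiv_symm_naturality, Equiv.symm_apply_apply] using h X

/-- The morphism `L ⊗ L ⟶ Z` induced by a family `(X* ⊗ X) ⊗ (Y* ⊗ Y) ⟶ Z` that is dinatural in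
both variables. -/
noncomputable def desc₂ {Z : C} (φ : ∀ X Y : C, (Xᘁ ⊗ X) ⊗ (Yᘁ ⊗ Y) ⟶ Z)
    (hφ : ∀ ⦃X X' Y Y' : C⦄ (f : X ⟶ X') (g : Y ⟶ Y'),
      ((fᘁ ▷ X) ⊗ₘ (gᘁ ▷ Y)) ≫ φ X Y = ((X'ᘁ ◁ f) ⊗ₘ (Y'ᘁ ◁ g)) ≫ φ X' Y') :
    canonicalCoend C ⊗ canonicalCoend C ⟶ Z :=
  descLeft (fun X => descRight (φ X) fun Y Y' g => by simpa using hφ (𝟙 X) g) fun X X' f =>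
    descRight_ext fun Y => by
      rw [whisker_exchange_assoc, whisker_exchange_assoc, dinat_descRight, dinat_descRight]
      simpa using hφ f (𝟙 Y)

theorem dinat_desc₂ {Z : C} (φ : ∀ X Y : C, (Xᘁ ⊗ X) ⊗ (Yᘁ ⊗ Y) ⟶ Z)
    (hφ : ∀ ⦃X X' Y Y' : C⦄ (f : X ⟶ X') (g : Y ⟶ Y'),
      ((fᘁ ▷ X) ⊗ₘ (gᘁ ▷ Y)) ≫ φ X Y = ((X'ᘁ ◁ f) ⊗ₘ (Y'ᘁ ◁ g)) ≫ φ X' Y') (X Y : C) :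
    (dinat X ⊗ₘ dinat Y) ≫ desc₂ φ hφ = φ X Y := by
  rw [MonoidalCategory.tensorHom_def', Category.assoc, desc₂, dinat_descLeft, dinat_descRight]

end Coend

section Pairings

variable {C : Type u} [Category.{v} C] [MonoidalCategory C]

theorem pairing_ext {A B W : C} [ExactPairing A B] {f g : W ⟶ B}
    (h : f ▷ A ≫ ε_ A B = g ▷ A ≫ ε_ A B) : f = g := by
  have hε : (tensorRightHomEquiv B A B (𝟙_ C)).symm (λ_ B).inv = ε_ A B := by
    simp only [tensorRightHomEquiv, Equiv.coe_fn_symm_mk]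
    monoidal
  rw [← cancel_mono (λ_ B).inv]
  apply (tensorRightHomEquiv W A B (𝟙_ C)).symm.injective
  rw [tensorRightHomEquiv_symm_naturality, tensorRightHomEquiv_symm_naturality, hε, h]

theorem tensor_pairing_natural {A A' B B' X X' Y Y' : C}
    {e : A ⊗ X ⟶ 𝟙_ C} {e' : A' ⊗ X' ⟶ 𝟙_ C} {d : B ⊗ Y ⟶ 𝟙_ C} {d' : B' ⊗ Y' ⟶ 𝟙_ C}
    {u : A' ⟶ A} {f : X ⟶ X'} {v : B' ⟶ B} {g : Y ⟶ Y'}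
    (hu : u ▷ X ≫ e = A' ◁ f ≫ e') (hv : v ▷ Y ≫ d = B' ◁ g ≫ d') :
    (v ⊗ₘ u) ▷ (X ⊗ Y) ≫ (𝟙 _ ⊗≫ B ◁ (e ▷ Y) ⊗≫ d) =
      (B' ⊗ A') ◁ (f ⊗ₘ g) ≫ (𝟙 _ ⊗≫ B' ◁ (e' ▷ Y') ⊗≫ d') := by
  calc (v ⊗ₘ u) ▷ (X ⊗ Y) ≫ (𝟙 _ ⊗≫ B ◁ (e ▷ Y) ⊗≫ d)
      = 𝟙 _ ⊗≫ B' ◁ ((u ▷ X) ▷ Y) ⊗≫ (v ▷ ((A ⊗ X) ⊗ Y) ≫ B ◁ (e ▷ Y)) ⊗≫ d := by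
        rw [MonoidalCategory.tensorHom_def']; monoidal
    _ = 𝟙 _ ⊗≫ B' ◁ ((u ▷ X ≫ e) ▷ Y) ⊗≫ (v ▷ Y ≫ d) := by
        rw [← whisker_exchange]; monoidal
    _ = 𝟙 _ ⊗≫ B' ◁ ((A' ◁ f) ▷ Y) ⊗≫ B' ◁ (e' ▷ Y ≫ 𝟙_ C ◁ g) ⊗≫ d' := by
        rw [hu, hv]; monoidal
    _ = _ := by rw [← whisker_exchange, MonoidalCategory.tensorHom_def]; monoidal


theorem rightAdjointMate_tensor [RigidCategory C] {X X' Y Y' : C} (f : X ⟶ X') (g : Y ⟶ Y') :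
    @rightAdjointMate C _ _ _ _ hasRightDualTensor hasRightDualTensor (f ⊗ₘ g) =
      (gᘁ ⊗ₘ fᘁ) := by
  let i1 : HasRightDual (X ⊗ Y) := hasRightDualTensor
  let i2 : HasRightDual (X' ⊗ Y') := hasRightDualTensor
  refine pairing_ext (A := X ⊗ Y) ?_
  refine (rightAdjointMate_comp_evaluation (f ⊗ₘ g)).trans ?_
  exact (tensor_pairing_natural (rightAdjointMate_comp_evaluation f)
    (rightAdjointMate_comp_evaluation g)).symm

theorem rightDualTensorIso_natural [RigidCategory C] {X X' Y Y' : C} (f : X ⟶ X')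
    (g : Y ⟶ Y') :
    (gᘁ ⊗ₘ fᘁ) ≫ (rightDualTensorIso X Y).inv =
      (rightDualTensorIso X' Y').inv ≫ (f ⊗ₘ g)ᘁ := by
  rw [← rightAdjointMate_tensor]
  simp only [rightDualTensorIso, rightDualIso]
  erw [← @comp_rightAdjointMate, ← @comp_rightAdjointMate]
  simp
  rfl

variable [BraidedCategory C]

/-- The double braiding `β_{B,X} ∘ β_{X,B}` on the first two of three factors. -/
def doubleBraid (X B Y : C) : X ⊗ (B ⊗ Y) ⟶ X ⊗ (B ⊗ Y) :=
  (α_ X B Y).inv ≫ ((β_ X B).hom ≫ (β_ B X).hom) ▷ Y ≫ (α_ X B Y).hom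

theorem doubleBraid_natural {X X' B B' Y Y' : C} (f : X ⟶ X') (b : B ⟶ B') (y : Y ⟶ Y') :
    (f ⊗ₘ (b ⊗ₘ y)) ≫ doubleBraid X' B' Y' = doubleBraid X B Y ≫ (f ⊗ₘ (b ⊗ₘ y)) := by
  have h : (f ⊗ₘ b) ≫ (β_ X' B').hom ≫ (β_ B' X').hom =
      ((β_ X B).hom ≫ (β_ B X).hom) ≫ (f ⊗ₘ b) := by simp
  have h' : ((f ⊗ₘ b) ⊗ₘ y) ≫ ((β_ X' B').hom ≫ (β_ B' X').hom) ▷ Y' =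
      ((β_ X B).hom ≫ (β_ B X).hom) ▷ Y ≫ ((f ⊗ₘ b) ⊗ₘ y) := by
    rw [← tensorHom_id, ← tensorHom_id, tensorHom_comp_tensorHom, tensorHom_comp_tensorHom, h,
      Category.comp_id, Category.id_comp]
  simp only [doubleBraid, Category.assoc]
  rw [associator_inv_naturality_assoc, reassoc_of% h', associator_naturality]

/-- `(e ⊗ d) ∘ (A ⊗ (β_{B,X} ∘ β_{X,B}) ⊗ Y)` for pairings `e : A ⊗ X ⟶ 𝟙` and
`d : B ⊗ Y ⟶ 𝟙`. -/
def linkedPairing {A X B Y : C} (e : A ⊗ X ⟶ 𝟙_ C) (d : B ⊗ Y ⟶ 𝟙_ C) :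
    (A ⊗ X) ⊗ (B ⊗ Y) ⟶ 𝟙_ C :=
  (α_ A X (B ⊗ Y)).hom ≫ A ◁ doubleBraid X B Y ≫ (α_ A X (B ⊗ Y)).inv ≫ (e ⊗ₘ d) ≫
    (λ_ (𝟙_ C)).hom

theorem linkedPairing_natural {A A' B B' X X' Y Y' : C}
    {e : A ⊗ X ⟶ 𝟙_ C} {e' : A' ⊗ X' ⟶ 𝟙_ C} {d : B ⊗ Y ⟶ 𝟙_ C} {d' : B' ⊗ Y' ⟶ 𝟙_ C}
    {u : A' ⟶ A} {f : X ⟶ X'} {v : B' ⟶ B} {g : Y ⟶ Y'}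
    (hu : u ▷ X ≫ e = A' ◁ f ≫ e') (hv : v ▷ Y ≫ d = B' ◁ g ≫ d') :
    ((u ▷ X) ⊗ₘ (v ▷ Y)) ≫ linkedPairing e d = ((A' ◁ f) ⊗ₘ (B' ◁ g)) ≫ linkedPairing e' d' := by
  have key : ∀ {P P' Q Q' R R' S S' : C} (p : P ⟶ P') (q : Q ⟶ Q') (r : R ⟶ R') (s : S ⟶ S')
      (e : P' ⊗ Q' ⟶ 𝟙_ C) (d : R' ⊗ S' ⟶ 𝟙_ C),
      ((p ⊗ₘ q) ⊗ₘ (r ⊗ₘ s)) ≫ linkedPairing e d =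
        (α_ P Q (R ⊗ S)).hom ≫ P ◁ doubleBraid Q R S ≫ (α_ P Q (R ⊗ S)).inv ≫
          (((p ⊗ₘ q) ≫ e) ⊗ₘ ((r ⊗ₘ s) ≫ d)) ≫ (λ_ (𝟙_ C)).hom := by
    intro P P' Q Q' R R' S S' p q r s e d
    have h' : (p ⊗ₘ (q ⊗ₘ (r ⊗ₘ s))) ≫ P' ◁ doubleBraid Q' R' S' =
        P ◁ doubleBraid Q R S ≫ (p ⊗ₘ (q ⊗ₘ (r ⊗ₘ s))) := by
      rw [← id_tensorHom, ← id_tensorHom, tensorHom_comp_tensorHom, tensorHom_comp_tensorHom,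
        doubleBraid_natural, Category.comp_id, Category.id_comp]
    simp only [linkedPairing]
    rw [associator_naturality_assoc, reassoc_of% h', associator_inv_naturality_assoc,
      tensorHom_comp_tensorHom_assoc]
  rw [← tensorHom_id, ← tensorHom_id, ← id_tensorHom, ← id_tensorHom, key, key]
  simp only [tensorHom_id, id_tensorHom, hu, hv]

/-- `(A ⊗ X) ⊗ (B ⊗ Y) ⟶ (B ⊗ A) ⊗ (X ⊗ Y)`, braiding `A ⊗ X` over `B`. -/
def slideBraid (A X B Y : C) : (A ⊗ X) ⊗ (B ⊗ Y) ⟶ (B ⊗ A) ⊗ (X ⊗ Y) :=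
  (α_ (A ⊗ X) B Y).inv ≫ (β_ (A ⊗ X) B).hom ▷ Y ≫ (α_ B (A ⊗ X) Y).hom ≫
    B ◁ (α_ A X Y).hom ≫ (α_ B A (X ⊗ Y)).inv

theorem slideBraid_natural {A A' B B' X X' Y Y' : C} (a : A ⟶ A') (x : X ⟶ X') (b : B ⟶ B')
    (y : Y ⟶ Y') : ((a ⊗ₘ x) ⊗ₘ (b ⊗ₘ y)) ≫ slideBraid A' X' B' Y' =
      slideBraid A X B Y ≫ ((b ⊗ₘ a) ⊗ₘ (x ⊗ₘ y)) := by
  have h : (((a ⊗ₘ x) ⊗ₘ b) ⊗ₘ y) ≫ (β_ (A' ⊗ X') B').hom ▷ Y' =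
      (β_ (A ⊗ X) B).hom ▷ Y ≫ ((b ⊗ₘ (a ⊗ₘ x)) ⊗ₘ y) := by
    rw [← tensorHom_id, ← tensorHom_id, tensorHom_comp_tensorHom, tensorHom_comp_tensorHom,
      BraidedCategory.braiding_naturality, Category.comp_id, Category.id_comp]
  have h' : (b ⊗ₘ ((a ⊗ₘ x) ⊗ₘ y)) ≫ B' ◁ (α_ A' X' Y').hom =
      B ◁ (α_ A X Y).hom ≫ (b ⊗ₘ (a ⊗ₘ (x ⊗ₘ y))) := by
    rw [← id_tensorHom, ← id_tensorHom, tensorHom_comp_tensorHom, tensorHom_comp_tensorHom,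
      associator_naturality, Category.comp_id, Category.id_comp]
  simp only [slideBraid, Category.assoc]
  rw [associator_inv_naturality_assoc, reassoc_of% h, associator_naturality_assoc,
    reassoc_of% h', associator_inv_naturality]

end Pairings

section HopfStructure

variable (C : Type u) [Category.{v} C] [MonoidalCategory C] [BraidedCategory C]
  [RigidCategory C] [HasCoend (innerHom C)]

/-- The Hopf pairing `ω : L ⊗ L ⟶ 𝟙`, given by
`ω ∘ (ι_X ⊗ ι_Y) = (ev_X ⊗ ev_Y) ∘ (X* ⊗ (β_{Y*,X} ∘ β_{X,Y*}) ⊗ Y)`. -/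
noncomputable def hopfPairing : canonicalCoend C ⊗ canonicalCoend C ⟶ 𝟙_ C :=
  desc₂ (fun X Y => linkedPairing (ε_ X Xᘁ) (ε_ Y Yᘁ)) fun _ _ _ _ f g =>
    linkedPairing_natural (rightAdjointMate_comp_evaluation f) (rightAdjointMate_comp_evaluation g)

/-- The product `μ : L ⊗ L ⟶ L`, given by
`μ ∘ (ι_X ⊗ ι_Y) = ι_{X ⊗ Y} ∘ (β_{X* ⊗ X, Y*} ⊗ Y)` up to the canonical isomorphism
`Y* ⊗ X* ≅ (X ⊗ Y)*`. -/
noncomputable def coendMul : canonicalCoend C ⊗ canonicalCoend C ⟶ canonicalCoend C :=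
  desc₂ (fun X Y => slideBraid Xᘁ X Yᘁ Y ≫ (rightDualTensorIso X Y).inv ▷ (X ⊗ Y) ≫
    dinat (X ⊗ Y)) fun X X' Y Y' f g => by
      rw [← tensorHom_id, ← tensorHom_id, ← id_tensorHom, ← id_tensorHom,
        reassoc_of% slideBraid_natural, reassoc_of% slideBraid_natural]
      congr 1
      rw [id_tensorHom_id, tensorHom_id, id_tensorHom_id, id_tensorHom, ← comp_whiskerRight_assoc,
        rightDualTensorIso_natural, comp_whiskerRight_assoc, dinat_condition,
        whisker_exchange_assoc]

theorem dinat_hopfPairing (X Y : C) : (dinat X ⊗ₘ dinat Y) ≫ hopfPairing C =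
    linkedPairing (ε_ X Xᘁ) (ε_ Y Yᘁ) := dinat_desc₂ _ _ X Y

theorem dinat_coendMul (X Y : C) : (dinat X ⊗ₘ dinat Y) ≫ coendMul C =
    slideBraid Xᘁ X Yᘁ Y ≫ (rightDualTensorIso X Y).inv ▷ (X ⊗ Y) ≫ dinat (X ⊗ Y) :=
  dinat_desc₂ _ _ X Y

variable {C} in
/-- The right coevaluation `𝟙 ⟶ X* ⊗ X` of the pivotal structure given by the twist:
`(X* ⊗ θ_X) ∘ β_{X,X*} ∘ coev_X`. -/
noncomputable def rightCoev [RibbonCategory C] (X : C) : 𝟙_ C ⟶ Xᘁ ⊗ X :=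
  η_ X Xᘁ ≫ (β_ X Xᘁ).hom ≫ Xᘁ ◁ (RibbonCategory.twist X).hom

variable {C} in
/-- The internal cocharacter `χ̌_X : 𝟙 ⟶ L` of `X`. -/
noncomputable def cocharacter [RibbonCategory C] (X : C) : 𝟙_ C ⟶ canonicalCoend C :=
  rightCoev X ≫ dinat X

variable {C} in
/-- The defect operator `𝒪_D = μ ∘ (χ̌_D ⊗ L) : L ⟶ L`. -/
noncomputable def defectOperator [RibbonCategory C] (D : C) :
    End (canonicalCoend C) :=
  (λ_ (canonicalCoend C)).inv ≫ cocharacter D ▷ canonicalCoend C ≫ coendMul C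

/-- The algebra `End_L(L)` of endomorphisms of `L` as a right `L`-module. The product of `f` and `g`
is the composite `f ∘ g`. -/
noncomputable def moduleEnd (k : Type w) [Field k] [Preadditive C] [Linear k C] [MonoidalPreadditive C]
    [MonoidalLinear k C] : Subalgebra k (End (canonicalCoend C)) where
  carrier := {f | (show canonicalCoend C ⟶ canonicalCoend C from f) ▷ canonicalCoend C ≫ coendMul C =
    coendMul C ≫ f}
  mul_mem' {f g} hf hg := by
    change (g ≫ f) ▷ canonicalCoend C ≫ coendMul C = coendMul C ≫ g ≫ f
    rw [comp_whiskerRight, Category.assoc, hf, reassoc_of% hg]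
  add_mem' {f g} hf hg := by
    change (f + g : canonicalCoend C ⟶ canonicalCoend C) ▷ canonicalCoend C ≫ coendMul C =
      coendMul C ≫ (f + g : canonicalCoend C ⟶ canonicalCoend C)
    rw [MonoidalPreadditive.add_whiskerRight, Preadditive.add_comp, Preadditive.comp_add, hf, hg]
  algebraMap_mem' r := by
    change (r • 𝟙 (canonicalCoend C)) ▷ canonicalCoend C ≫ coendMul C =
      coendMul C ≫ (r • 𝟙 (canonicalCoend C))
    simp

end HopfStructure

section Grothendieck

theorem shortExact_whiskerLeft {C : Type u} [Category.{v} C] [Abelian C] [MonoidalCategory C]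
    [MonoidalPreadditive C] [RigidCategory C] (X : C) {S : ShortComplex C} (hS : S.ShortExact) :
    (S.map (tensorLeft X)).ShortExact := by
  have h3 := (tensorLeftAdjunction (ᘁX) X).leftAdjoint_preservesColimits
  have h4 := (tensorLeftAdjunction X Xᘁ).rightAdjoint_preservesLimits
  exact hS.map_of_exact (tensorLeft X)

variable (C : Type u) [Category.{v} C] [Abelian C] [MonoidalCategory C]
  [MonoidalPreadditive C] [BraidedCategory C] [RigidCategory C]

/-- The relations `[X₂] = [X₁] + [X₃]` for short exact sequences `0 ⟶ X₁ ⟶ X₂ ⟶ X₃ ⟶ 0` in the free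
abelian group on isomorphism classes of objects. That group is a ring under `[X][Y] = [X ⊗ Y]`. -/
def grothendieckRelations : Set (MonoidAlgebra ℤ (Skeleton C)) :=
  {r | ∃ S : ShortComplex C, S.ShortExact ∧
    r = .of ℤ _ (toSkeleton S.X₂) - .of ℤ _ (toSkeleton S.X₁) - .of ℤ _ (toSkeleton S.X₃)}

/-- The subgroup generated by the relations. It is an ideal, because tensor products are exact. -/
noncomputable def grothendieckIdeal : Ideal (MonoidAlgebra ℤ (Skeleton C)) where
  toAddSubmonoid := (AddSubgroup.closure (grothendieckRelations C)).toAddSubmonoid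
  smul_mem' a x hx := by
    change x ∈ AddSubgroup.closure (grothendieckRelations C) at hx
    change a * x ∈ AddSubgroup.closure (grothendieckRelations C)
    have h : ∀ b : Skeleton C, .of ℤ _ b * x ∈ AddSubgroup.closure (grothendieckRelations C) := by
      intro b
      induction hx using AddSubgroup.closure_induction with
      | mem y hy =>
        obtain ⟨S, hS, rfl⟩ := hy
        obtain ⟨X, rfl⟩ : ∃ X : C, toSkeleton X = b := Quotient.exists_rep b
        refine AddSubgroup.subset_closure ⟨_, shortExact_whiskerLeft X hS, ?_⟩
        simp only [mul_sub, ← map_mul, ← Skeleton.toSkeleton_tensorObj]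
        rfl
      | zero => simp
      | add y z _ _ hy hz => rw [mul_add]; exact add_mem hy hz
      | neg y _ hy => rw [mul_neg]; exact neg_mem hy
    induction a using MonoidAlgebra.induction_on with
    | of b => exact h b
    | add f g hf hg => rw [add_mul]; exact add_mem hf hg
    | smul r f hf => rw [smul_mul_assoc]; exact zsmul_mem hf r

/-- The Grothendieck ring `Gr(C)`: its additive group is the free abelian group on isomorphism classes
of objects modulo short exact sequences, and its product is `[X][Y] = [X ⊗ Y]`. -/
abbrev GrothendieckRing := MonoidAlgebra ℤ (Skeleton C) ⧸ grothendieckIdeal C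

/-- The class `[X]` in the Grothendieck ring. -/
noncomputable def grothendieckClass (X : C) : GrothendieckRing C :=
  Ideal.Quotient.mk _ (.of ℤ _ (toSkeleton X))

/-- The linearised Grothendieck ring `Gr_k(C) = k ⊗_ℤ Gr(C)`. -/
abbrev LinearGrothendieckRing (k : Type w) [Field k] := TensorProduct ℤ k (GrothendieckRing C)

end Grothendieck

section Modular

/-- A finite tensor category: a finite `k`-linear rigid monoidal category with bilinear tensor
product and simple unit. -/
class IsFiniteTensorCategory (k : Type w) [Field k] (C : Type u) [Category.{v} C] [Abelian C]
    [Linear k C] [MonoidalCategory C] [MonoidalPreadditive C] [MonoidalLinear k C]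
    [RigidCategory C] : Prop extends IsFiniteLinear k C where
  simple_unit : Simple (𝟙_ C)

/-- A modular tensor category: a finite ribbon category for which the Hopf pairing of the canonical
coend is non-degenerate, that is, the evaluation of an exact pairing of `L` with itself. -/
class IsModularTensorCategory (k : Type w) [Field k] (C : Type u) [Category.{v} C] [Abelian C]
    [Linear k C] [MonoidalCategory C] [MonoidalPreadditive C] [MonoidalLinear k C]
    [RigidCategory C] [BraidedCategory C] [RibbonCategory C] : Prop
    extends IsFiniteTensorCategory k C where
  nondegenerate : haveI : HasCoend (innerHom C) := hasCoend_innerHom k C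
    ∃ p : ExactPairing (canonicalCoend C) (canonicalCoend C), p.evaluation' = hopfPairing C

end Modular
end ModularTensor

open ModularTensor

/-! The operator `defectOperator D` is left multiplication by the element `cocharacter D` of the
algebra `L`. Since the product is associative (`coendMul_assoc`), left multiplications commute with
the right action, so they lie in `moduleEnd`.

The assignment of `cocharacter D` to `D` is multiplicative (`cocharacter_tensor`): the double
braiding in the twist of a tensor product absorbs the crossing of the two coevaluations. It is
unital and additive on short exact sequences (`cocharacter_shortExact`). Hence `D ↦ defectOperator
D` induces an algebra map from the linearised Grothendieck ring to `moduleEnd`. As the classes of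
objects span its source, its range is the subalgebra generated by the defect operators.

For injectivity, the classes of simple objects span the Grothendieck ring, and applying
`defectOperator D` to `cocharacter (𝟙_ C)` returns `cocharacter D`. It remains to see that the
cocharacters of pairwise non-isomorphic simples are independent
(`eq_zero_of_sum_cocharacter_eq_zero`). Let `u : 𝟙 ⟶ I` be a monomorphism into an injective object.
Morphisms `L ⟶ I` come from natural transformations `X ⟶ X ⊗ I`. By `exists_natural_extension` such
a transformation can be prescribed on one simple object and be zero on finitely many others. A
suitable choice gives a morphism `L ⟶ I` that sends one cocharacter to `u` and the remaining ones to
zero.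

The natural transformations are Casimir sums. In the category of `A`-modules, with `P = A` and `N`
the dual of `A`, the spaces `P ⟶ X` and `X ⟶ N` are dual to each other. Summing over dual bases
turns any `h : N ⟶ P ⊗ I` into a natural transformation, and `h` can be chosen with prescribed
effect on a semisimple object that is both a quotient of `P` and a subobject of `N`. -/

namespace ModularTensor

/-! ### Pairings, their mates, and nesting of pairings. -/

section Mates

variable {C : Type u} [Category.{v} C] [MonoidalCategory C]

/-- The morphism `A ⟶ X*` corresponding to a pairing `A ⊗ X ⟶ 𝟙`. -/
def mate {A X : C} [HasRightDual X] (e : A ⊗ X ⟶ 𝟙_ C) : A ⟶ Xᘁ :=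
  tensorRightHomEquiv A X Xᘁ (𝟙_ C) e ≫ (λ_ Xᘁ).hom

theorem mate_evaluation {A X : C} [HasRightDual X] (e : A ⊗ X ⟶ 𝟙_ C) :
    mate e ▷ X ≫ ε_ X Xᘁ = e := by
  have h := (tensorRightHomEquiv A X Xᘁ (𝟙_ C)).symm_apply_apply e
  conv_rhs => rw [← h]
  simp only [mate, tensorRightHomEquiv, Equiv.coe_fn_symm_mk, Equiv.coe_fn_mk]
  monoidal

theorem mate_eq {A X : C} [HasRightDual X] {e : A ⊗ X ⟶ 𝟙_ C} {m : A ⟶ Xᘁ}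
    (h : m ▷ X ≫ ε_ X Xᘁ = e) : mate e = m :=
  pairing_ext (by rw [mate_evaluation, h])

theorem mate_comp_left {A B X : C} [HasRightDual X] (a : A ⟶ B) (e : B ⊗ X ⟶ 𝟙_ C) :
    mate (a ▷ X ≫ e) = a ≫ mate e :=
  mate_eq (by rw [comp_whiskerRight, Category.assoc, mate_evaluation])

theorem mate_comp_right {A X Y : C} [HasRightDual X] [HasRightDual Y] (f : X ⟶ Y)
    (e : A ⊗ Y ⟶ 𝟙_ C) : mate (A ◁ f ≫ e) = mate e ≫ fᘁ :=
  mate_eq (by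
    rw [comp_whiskerRight, Category.assoc, rightAdjointMate_comp_evaluation,
      ← whisker_exchange_assoc, mate_evaluation])

/-- The mate of the evaluation compares an arbitrary right dual with the chosen one. Compatibility
with coevaluations lets a cocharacter be computed from any right dual. -/
theorem coevaluation_mate (X A : C) [ExactPairing X A] [HasRightDual X] :
    η_ X A ≫ X ◁ mate (ε_ X A) = η_ X Xᘁ := by
  have h : mate (ε_ X A) = 𝟙 _ ⊗≫ A ◁ η_ X Xᘁ ⊗≫ ε_ X A ▷ Xᘁ ⊗≫ 𝟙 _ := by
    simp only [mate, tensorRightHomEquiv, Equiv.coe_fn_mk]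
    monoidal
  rw [h]
  calc _ = 𝟙 _ ⊗≫ (η_ X A ▷ 𝟙_ C ≫ (X ⊗ A) ◁ η_ X Xᘁ) ⊗≫ X ◁ ε_ X A ▷ Xᘁ ⊗≫ 𝟙 _ := by monoidal
    _ = η_ X Xᘁ ⊗≫ (η_ X A ▷ X ⊗≫ X ◁ ε_ X A) ▷ Xᘁ ⊗≫ 𝟙 _ := by
      rw [← whisker_exchange]; monoidal
    _ = _ := by rw [ExactPairing.evaluation_coevaluation'']; monoidal

/-- The pairing of `B ⊗ A` with `X ⊗ Y` built from pairings of `A` with `X` and of `B` with `Y`. -/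
def nestedPairing {A X B Y : C} (e : A ⊗ X ⟶ 𝟙_ C) (d : B ⊗ Y ⟶ 𝟙_ C) :
    (B ⊗ A) ⊗ (X ⊗ Y) ⟶ 𝟙_ C :=
  𝟙 _ ⊗≫ B ◁ (e ▷ Y) ⊗≫ d

theorem nestedPairing_natural {A A' X X' B B' Y Y' : C} (a : A ⟶ A') (x : X ⟶ X') (b : B ⟶ B')
    (y : Y ⟶ Y') (e : A' ⊗ X' ⟶ 𝟙_ C) (d : B' ⊗ Y' ⟶ 𝟙_ C) :
    ((b ⊗ₘ a) ⊗ₘ (x ⊗ₘ y)) ≫ nestedPairing e d =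
      nestedPairing ((a ⊗ₘ x) ≫ e) ((b ⊗ₘ y) ≫ d) := by
  calc _ = 𝟙 _ ⊗≫ b ▷ (A ⊗ X ⊗ Y) ⊗≫ B' ◁ ((a ⊗ₘ x) ▷ Y) ⊗≫ B' ◁ (e ▷ Y ≫ 𝟙_ C ◁ y) ⊗≫
          d := by
        rw [← whisker_exchange, MonoidalCategory.tensorHom_def (b ⊗ₘ a)]
        simp only [nestedPairing, MonoidalCategory.tensorHom_def]
        monoidal
    _ = 𝟙 _ ⊗≫ (b ▷ ((A ⊗ X) ⊗ Y) ≫ B' ◁ (((a ⊗ₘ x) ≫ e) ▷ Y)) ⊗≫ B' ◁ y ⊗≫ d := by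
        monoidal
    _ = _ := by
        rw [← whisker_exchange, MonoidalCategory.tensorHom_def b y]
        simp only [nestedPairing]
        monoidal

theorem nestedPairing_assoc {A X B Y D Z : C} (e : A ⊗ X ⟶ 𝟙_ C) (d : B ⊗ Y ⟶ 𝟙_ C)
    (c : D ⊗ Z ⟶ 𝟙_ C) :
    ((α_ D B A).hom ⊗ₘ (α_ X Y Z).inv) ≫ nestedPairing (nestedPairing e d) c =
      nestedPairing e (nestedPairing d c) := by
  simp only [nestedPairing, MonoidalCategory.tensorHom_def]
  monoidal

/-- By definition the canonical isomorphism is the dual of an identity, taken with respect to two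
different duals of `X ⊗ Y`; such a morphism is a mate of the evaluation. -/
theorem mate_nestedPairing [RigidCategory C] (X Y : C) :
    mate (nestedPairing (ε_ X Xᘁ) (ε_ Y Yᘁ)) = (rightDualTensorIso X Y).inv := by
  apply mate_eq
  have := @rightAdjointMate_comp_evaluation C _ _ (X ⊗ Y) (X ⊗ Y) _ hasRightDualTensor
    (𝟙 (X ⊗ Y))
  refine this.trans ?_
  rw [MonoidalCategory.whiskerLeft_id, Category.id_comp]
  rfl

end Mates

/-! ### The universal dinatural transformation for arbitrary pairings. -/

section PairingDinat

variable {C : Type u} [Category.{v} C] [MonoidalCategory C] [RigidCategory C]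
  [HasCoend (innerHom C)]

/-- The morphism `A ⊗ X ⟶ L` attached to a pairing `A ⊗ X ⟶ 𝟙`. -/
noncomputable def pairingDinat {A X : C} (e : A ⊗ X ⟶ 𝟙_ C) : A ⊗ X ⟶ canonicalCoend C :=
  mate e ▷ X ≫ dinat X

theorem pairingDinat_evaluation (X : C) : pairingDinat (ε_ X Xᘁ) = dinat X := by
  have : mate (ε_ X Xᘁ) = 𝟙 _ := mate_eq (by simp)
  simp [pairingDinat, this]

theorem pairingDinat_natural {A A' X X' : C} (a : A ⟶ A') (x : X ⟶ X') (e : A' ⊗ X' ⟶ 𝟙_ C) :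
    (a ⊗ₘ x) ≫ pairingDinat e = pairingDinat ((a ⊗ₘ x) ≫ e) := by
  rw [MonoidalCategory.tensorHom_def, Category.assoc, Category.assoc]
  simp only [pairingDinat]
  rw [mate_comp_left, mate_comp_right, whisker_exchange_assoc, comp_whiskerRight,
    comp_whiskerRight, Category.assoc, Category.assoc, dinat_condition]

/-- With arbitrary pairings allowed, the product formula contains no identification of duals. It has
the same shape on both sides and can be iterated. -/
theorem pairingDinat_coendMul [BraidedCategory C] {A X B Y : C} (e : A ⊗ X ⟶ 𝟙_ C)
    (d : B ⊗ Y ⟶ 𝟙_ C) : (pairingDinat e ⊗ₘ pairingDinat d) ≫ coendMul C =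
      slideBraid A X B Y ≫ pairingDinat (nestedPairing e d) := by
  have he : e = (mate e ⊗ₘ 𝟙 X) ≫ ε_ X Xᘁ := by rw [tensorHom_id, mate_evaluation]
  have hd : d = (mate d ⊗ₘ 𝟙 Y) ≫ ε_ Y Yᘁ := by rw [tensorHom_id, mate_evaluation]
  conv_rhs => rw [he, hd, ← nestedPairing_natural, ← pairingDinat_natural,
    ← reassoc_of% slideBraid_natural]
  rw [show pairingDinat (nestedPairing (ε_ X Xᘁ) (ε_ Y Yᘁ)) =
      (rightDualTensorIso X Y).inv ▷ (X ⊗ Y) ≫ dinat (X ⊗ Y) by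
      rw [pairingDinat, mate_nestedPairing], ← dinat_coendMul, tensorHom_id, tensorHom_id,
    tensorHom_comp_tensorHom_assoc]
  rfl

/-- Tensoring with a rigid object has a right adjoint on either side, so the other two factors can
be transposed away and the coend treated one variable at a time. -/
theorem coend_hom_ext₃ {Z : C}
    {f g : (canonicalCoend C ⊗ canonicalCoend C) ⊗ canonicalCoend C ⟶ Z}
    (h : ∀ X Y W : C, ((dinat X ⊗ₘ dinat Y) ⊗ₘ dinat W) ≫ f =
      ((dinat X ⊗ₘ dinat Y) ⊗ₘ dinat W) ≫ g) : f = g := by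
  have ext₁ : ∀ {V V' Z : C} {f g : (V ⊗ canonicalCoend C) ⊗ V' ⟶ Z},
      (∀ X, (V ◁ dinat X) ▷ V' ≫ f = (V ◁ dinat X) ▷ V' ≫ g) → f = g := by
    intro V V' Z f g h
    apply (tensorRightHomEquiv _ V' (HasRightDual.rightDual V') Z).injective
    refine descRight_ext fun X => ?_
    apply (tensorRightHomEquiv _ V' (HasRightDual.rightDual V') Z).symm.injective
    simpa only [tensorRightHomEquiv_symm_naturality, Equiv.symm_apply_apply] using h X
  have ext₂ : ∀ {V V' Z : C} {f g : (canonicalCoend C ⊗ V) ⊗ V' ⟶ Z},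
      (∀ X, (dinat X ▷ V) ▷ V' ≫ f = (dinat X ▷ V) ▷ V' ≫ g) → f = g := by
    intro V V' Z f g h
    apply (tensorRightHomEquiv _ V' (HasRightDual.rightDual V') Z).injective
    apply (tensorRightHomEquiv _ V (HasRightDual.rightDual V) _).injective
    refine canonicalCoend_hom_ext fun X => ?_
    apply (tensorRightHomEquiv _ V (HasRightDual.rightDual V) _).symm.injective
    apply (tensorRightHomEquiv _ V' (HasRightDual.rightDual V') Z).symm.injective
    simpa only [tensorRightHomEquiv_symm_naturality, Equiv.symm_apply_apply] using h X
  refine descRight_ext fun W => ext₁ fun Y => ext₂ fun X => ?_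
  have := h X Y W
  simpa only [MonoidalCategory.tensorHom_def, comp_whiskerRight, Category.assoc] using this

end PairingDinat

/-! ### Associativity of the product on the coend. -/

section Associativity

variable {C : Type u} [Category.{v} C] [MonoidalCategory C] [BraidedCategory C]

theorem slideBraid_assoc (A X B Y D Z : C) :
    slideBraid A X B Y ▷ (D ⊗ Z) ≫ slideBraid (B ⊗ A) (X ⊗ Y) D Z =
      (α_ (A ⊗ X) (B ⊗ Y) (D ⊗ Z)).hom ≫ (A ⊗ X) ◁ slideBraid B Y D Z ≫
        slideBraid A X (D ⊗ B) (Y ⊗ Z) ≫ ((α_ D B A).hom ⊗ₘ (α_ X Y Z).inv) := by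
  calc _ = (α_ _ _ _).inv ≫ (slideBraid A X B Y ▷ D ≫ (β_ ((B ⊗ A) ⊗ (X ⊗ Y)) D).hom) ▷ Z ⊗≫
        𝟙 _ := by
        simp only [slideBraid]; monoidal
    _ = _ := by
      rw [BraidedCategory.braiding_naturality_left, BraidedCategory.braiding_tensor_left_hom]
      simp only [slideBraid, BraidedCategory.braiding_tensor_right_hom _ D B,
        MonoidalCategory.tensorHom_def]
      -- Naturality and the hexagons have turned both sides into the same word in these three
      -- braidings. Once they are opaque, only coherence is left.
      generalize (β_ (A ⊗ X) B).hom = s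
      generalize (β_ (A ⊗ X) D).hom = t
      generalize (β_ (B ⊗ Y) D).hom = r
      monoidal

variable [RigidCategory C] [HasCoend (innerHom C)]

theorem coendMul_assoc : coendMul C ▷ canonicalCoend C ≫ coendMul C =
    (α_ _ _ _).hom ≫ canonicalCoend C ◁ coendMul C ≫ coendMul C := by
  refine coend_hom_ext₃ fun X Y W => ?_
  have h1 : ((dinat X ⊗ₘ dinat Y) ⊗ₘ dinat W) ≫ coendMul C ▷ canonicalCoend C ≫ coendMul C =
      slideBraid (HasRightDual.rightDual X) X (HasRightDual.rightDual Y) Y ▷ _ ≫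
        slideBraid _ _ (HasRightDual.rightDual W) W ≫
        pairingDinat (nestedPairing (nestedPairing (ε_ X Xᘁ) (ε_ Y Yᘁ)) (ε_ W Wᘁ)) := by
    rw [← pairingDinat_coendMul, pairingDinat_evaluation, ← tensorHom_id,
      tensorHom_comp_tensorHom_assoc, ← pairingDinat_evaluation X, ← pairingDinat_evaluation Y,
      pairingDinat_coendMul, ← tensorHom_id, tensorHom_comp_tensorHom_assoc]
    simp
  have h2 : ((dinat X ⊗ₘ dinat Y) ⊗ₘ dinat W) ≫ (α_ _ _ _).hom ≫
      canonicalCoend C ◁ coendMul C ≫ coendMul C =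
      (α_ _ _ _).hom ≫ _ ◁ slideBraid (HasRightDual.rightDual Y) Y (HasRightDual.rightDual W) W ≫
        slideBraid (HasRightDual.rightDual X) X _ _ ≫
        pairingDinat (nestedPairing (ε_ X Xᘁ) (nestedPairing (ε_ Y Yᘁ) (ε_ W Wᘁ))) := by
    rw [associator_naturality_assoc, ← pairingDinat_coendMul, pairingDinat_evaluation X,
      ← id_tensorHom, tensorHom_comp_tensorHom_assoc, ← pairingDinat_evaluation Y,
      ← pairingDinat_evaluation W, pairingDinat_coendMul, ← id_tensorHom,
      tensorHom_comp_tensorHom_assoc]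
    simp
  rw [h1, h2, ← nestedPairing_assoc, ← pairingDinat_natural]
  simpa only [Category.assoc] using congrArg (· ≫ pairingDinat _) (slideBraid_assoc
    (HasRightDual.rightDual X) X (HasRightDual.rightDual Y) Y (HasRightDual.rightDual W) W)

theorem defectOperator_mem_moduleEnd [RibbonCategory C] (k : Type w) [Field k] [Preadditive C]
    [Linear k C] [MonoidalPreadditive C] [MonoidalLinear k C] (D : C) :
    defectOperator D ∈ moduleEnd C k := by
  change ((λ_ (canonicalCoend C)).inv ≫ cocharacter D ▷ canonicalCoend C ≫ coendMul C) ▷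
    canonicalCoend C ≫ coendMul C = coendMul C ≫ (λ_ (canonicalCoend C)).inv ≫
      cocharacter D ▷ canonicalCoend C ≫ coendMul C
  rw [comp_whiskerRight, comp_whiskerRight, Category.assoc, Category.assoc, coendMul_assoc,
    associator_naturality_left_assoc, ← whisker_exchange_assoc,
    leftUnitor_inv_naturality_assoc]
  simp

end Associativity

/-! ### Braid calculus for coevaluations. -/

section Cups

variable {C : Type u} [Category.{v} C] [MonoidalCategory C]

/-- The element of `(X ⊗ Y) ⊗ (B ⊗ A)` nesting `d` inside `c`. -/
def nestedCup {X A Y B : C} (c : 𝟙_ C ⟶ X ⊗ A) (d : 𝟙_ C ⟶ Y ⊗ B) :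
    𝟙_ C ⟶ (X ⊗ Y) ⊗ (B ⊗ A) :=
  c ⊗≫ (X ◁ d) ▷ A ⊗≫ 𝟙 _

theorem nestedCup_comp {X X' A Y Y' B : C} (c : 𝟙_ C ⟶ X ⊗ A) (d : 𝟙_ C ⟶ Y ⊗ B) (f : X ⟶ X')
    (g : Y ⟶ Y') : nestedCup c d ≫ (f ⊗ₘ g) ▷ (B ⊗ A) = nestedCup (c ≫ f ▷ A) (d ≫ g ▷ B) := by
  simp only [nestedCup]
  calc _ = c ⊗≫ (X ◁ d ≫ f ▷ (Y ⊗ B)) ▷ A ⊗≫ (X' ◁ g) ▷ (B ⊗ A) ⊗≫ 𝟙 _ := by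
        rw [MonoidalCategory.tensorHom_def]
        monoidal
    _ = _ := by
        rw [whisker_exchange]
        monoidal

variable [BraidedCategory C]

/-- A strand crossing both legs of a cup can be pulled off it. Crossing one leg is therefore the
same as starting on the other side and crossing the other leg backwards. -/
theorem braiding_inv_cup {X Y B : C} (d : 𝟙_ C ⟶ Y ⊗ B) :
    𝟙 X ⊗≫ X ◁ d ⊗≫ (β_ X Y).hom ▷ B ⊗≫ 𝟙 (Y ⊗ X ⊗ B) =
      𝟙 X ⊗≫ d ▷ X ⊗≫ Y ◁ (β_ X B).inv ⊗≫ 𝟙 (Y ⊗ X ⊗ B) := by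
  have h := BraidedCategory.braiding_naturality_right X d
  rw [braiding_tensorUnit_right, BraidedCategory.braiding_tensor_right_hom] at h
  calc _ = 𝟙 _ ⊗≫ (X ◁ d ≫ (α_ X Y B).inv ≫ (β_ X Y).hom ▷ B ≫ (α_ Y X B).hom ≫
        Y ◁ (β_ X B).hom ≫ (α_ Y B X).inv) ⊗≫ Y ◁ (β_ X B).inv ⊗≫ 𝟙 _ := by
        have : (β_ X B).hom ≫ (β_ X B).inv = 𝟙 _ := by simp
        calc _ = 𝟙 _ ⊗≫ X ◁ d ⊗≫ (β_ X Y).hom ▷ B ⊗≫ Y ◁ ((β_ X B).hom ≫ (β_ X B).inv)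
              ⊗≫ 𝟙 _ := by rw [this]; monoidal
          _ = _ := by monoidal
    _ = _ := by rw [h]; monoidal

theorem braiding_cup {A X Y : C} (c : 𝟙_ C ⟶ X ⊗ A) :
    𝟙 Y ⊗≫ Y ◁ c ⊗≫ (β_ Y X).hom ▷ A ⊗≫ X ◁ (β_ Y A).hom ⊗≫ 𝟙 (X ⊗ A ⊗ Y) =
      𝟙 Y ⊗≫ c ▷ Y ⊗≫ 𝟙 (X ⊗ A ⊗ Y) := by
  have h := BraidedCategory.braiding_naturality_right Y c
  rw [braiding_tensorUnit_right, BraidedCategory.braiding_tensor_right_hom] at h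
  calc _ = 𝟙 _ ⊗≫ (Y ◁ c ≫ (α_ Y X A).inv ≫ (β_ Y X).hom ▷ A ≫ (α_ X Y A).hom ≫
        X ◁ (β_ Y A).hom ≫ (α_ X A Y).inv) ⊗≫ 𝟙 _ := by monoidal
    _ = _ := by rw [h]; monoidal

/-- This is the geometric core of multiplicativity. The left side is the double braiding coming from
the twist of `X ⊗ Y`, followed by the braiding past the dual; on the right each strand crosses only
its own dual. -/
theorem nestedCup_braiding {X A Y B : C} (c : 𝟙_ C ⟶ X ⊗ A) (d : 𝟙_ C ⟶ Y ⊗ B) :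
    nestedCup c d ≫ ((β_ X Y).hom ≫ (β_ Y X).hom) ▷ (B ⊗ A) ≫ (β_ (X ⊗ Y) (B ⊗ A)).hom =
      (d ≫ (β_ Y B).hom) ⊗≫ B ◁ ((c ≫ (β_ X A).hom) ▷ Y) ⊗≫ 𝟙 _ := by
  -- Yang–Baxter moves the crossing of `X` with `B` to the front, where it cancels the inverse
  -- crossing produced by `braiding_inv_cup`. The crossings of `Y` with `X` and `A` that remain are
  -- removed by `braiding_cup`.
  have hinner : (β_ Y X).hom ▷ B ⊗≫ X ◁ (β_ Y B).hom ⊗≫ (β_ X B).hom ▷ Y =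
      𝟙 _ ⊗≫ Y ◁ (β_ X B).hom ⊗≫ (β_ Y B).hom ▷ X ⊗≫ B ◁ (β_ Y X).hom ⊗≫ 𝟙 _ := by
    rw [BraidedCategory.yang_baxter' Y X B]
    monoidal
  have hcancel : (β_ X B).inv ≫ (β_ X B).hom = 𝟙 _ := by simp
  calc _ = c ⊗≫ (𝟙 X ⊗≫ X ◁ d ⊗≫ (β_ X Y).hom ▷ B ⊗≫ 𝟙 (Y ⊗ X ⊗ B)) ▷ A ⊗≫
          ((β_ Y X).hom ▷ B ⊗≫ X ◁ (β_ Y B).hom ⊗≫ (β_ X B).hom ▷ Y) ▷ A ⊗≫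
          B ◁ (X ◁ (β_ Y A).hom ⊗≫ (β_ X A).hom ▷ Y) ⊗≫ 𝟙 _ := by
        rw [nestedCup, BraidedCategory.braiding_tensor_right_hom,
          BraidedCategory.braiding_tensor_left_hom, BraidedCategory.braiding_tensor_left_hom]
        monoidal
    _ = c ⊗≫ d ▷ (X ⊗ A) ⊗≫ Y ◁ ((β_ X B).inv ≫ (β_ X B).hom) ▷ A ⊗≫
          (β_ Y B).hom ▷ X ▷ A ⊗≫ B ◁ (β_ Y X).hom ▷ A ⊗≫
          B ◁ (X ◁ (β_ Y A).hom ⊗≫ (β_ X A).hom ▷ Y) ⊗≫ 𝟙 _ := by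
        rw [braiding_inv_cup, hinner]
        monoidal
    _ = 𝟙 _ ⊗≫ (𝟙_ C ◁ c ≫ (d ≫ (β_ Y B).hom) ▷ (X ⊗ A)) ⊗≫ B ◁ (β_ Y X).hom ▷ A ⊗≫
          B ◁ (X ◁ (β_ Y A).hom ⊗≫ (β_ X A).hom ▷ Y) ⊗≫ 𝟙 _ := by
        rw [hcancel]
        monoidal
    _ = (d ≫ (β_ Y B).hom) ⊗≫
          B ◁ (𝟙 Y ⊗≫ Y ◁ c ⊗≫ (β_ Y X).hom ▷ A ⊗≫ X ◁ (β_ Y A).hom ⊗≫ 𝟙 (X ⊗ A ⊗ Y)) ⊗≫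
          B ◁ ((β_ X A).hom ▷ Y) ⊗≫ 𝟙 _ := by
        rw [whisker_exchange]
        monoidal
    _ = _ := by
        rw [braiding_cup]
        monoidal

theorem tensorHom_slideBraid {A X B Y : C} (c : 𝟙_ C ⟶ A ⊗ X) (d : 𝟙_ C ⟶ B ⊗ Y) :
    (λ_ (𝟙_ C)).inv ≫ (c ⊗ₘ d) ≫ slideBraid A X B Y = d ⊗≫ B ◁ (c ▷ Y) ⊗≫ 𝟙 _ := by
  have h := BraidedCategory.braiding_naturality_left c B
  rw [braiding_tensorUnit_left] at h
  calc _ = d ⊗≫ (c ▷ B ≫ (β_ (A ⊗ X) B).hom) ▷ Y ⊗≫ 𝟙 _ := by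
        rw [MonoidalCategory.tensorHom_def', slideBraid]
        calc _ = 𝟙 _ ⊗≫ (𝟙_ C ◁ d) ⊗≫ (c ▷ B ≫ (β_ (A ⊗ X) B).hom) ▷ Y ⊗≫ 𝟙 _ := by monoidal
          _ = _ := by monoidal
    _ = _ := by rw [h]; monoidal

theorem unit_slideBraid {B Y : C} (c : 𝟙_ C ⟶ 𝟙_ C ⊗ 𝟙_ C) :
    (λ_ (B ⊗ Y)).inv ≫ c ▷ (B ⊗ Y) ≫ slideBraid (𝟙_ C) (𝟙_ C) B Y =
      𝟙 _ ⊗≫ B ◁ (c ▷ Y) ⊗≫ 𝟙 _ := by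
  have h := BraidedCategory.braiding_naturality_left c B
  rw [braiding_tensorUnit_left] at h
  calc _ = 𝟙 _ ⊗≫ (c ▷ B ≫ (β_ (𝟙_ C ⊗ 𝟙_ C) B).hom) ▷ Y ⊗≫ 𝟙 _ := by
        rw [slideBraid]
        monoidal
    _ = _ := by rw [h]; monoidal

end Cups

/-! ### Multiplicativity of cocharacters and defect operators. -/

section Cocharacters

variable {C : Type u} [Category.{v} C] [MonoidalCategory C] [BraidedCategory C]
  [RigidCategory C] [RibbonCategory C]

/-- The braiding of the unit with itself is trivial, so `twist_tensor` and naturality along `𝟙 ⊗ 𝟙 ≅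
𝟙` make the twist of the unit idempotent. An invertible idempotent is the identity. -/
theorem twist_unit : (RibbonCategory.twist (𝟙_ C)).hom = 𝟙 _ := by
  have h := RibbonCategory.twist_tensor (𝟙_ C) (𝟙_ C)
  have h2 := RibbonCategory.twist_naturality (λ_ (𝟙_ C)).hom
  rw [h] at h2
  have hb : (β_ (𝟙_ C) (𝟙_ C)).hom = 𝟙 _ := by
    rw [braiding_tensorUnit_left, unitors_equal]; simp
  rw [hb, Category.comp_id, Category.comp_id, MonoidalCategory.tensorHom_def', Category.assoc] at h2
  have h3 : (RibbonCategory.twist (𝟙_ C)).hom ≫ (RibbonCategory.twist (𝟙_ C)).hom =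
      (RibbonCategory.twist (𝟙_ C)).hom := by
    rw [unitors_equal, rightUnitor_naturality, ← unitors_equal, leftUnitor_naturality_assoc] at h2
    exact ((cancel_epi _).1 h2).symm
  rw [← cancel_epi (RibbonCategory.twist (𝟙_ C)).hom, h3, Category.comp_id]

theorem rightCoev_naturality {X Y : C} (f : X ⟶ Y) :
    rightCoev X ≫ Xᘁ ◁ f = rightCoev Y ≫ fᘁ ▷ Y := by
  have h := RibbonCategory.twist_naturality f
  simp only [rightCoev, Category.assoc]
  rw [← MonoidalCategory.whiskerLeft_comp, ← h, MonoidalCategory.whiskerLeft_comp,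
    whisker_exchange, ← BraidedCategory.braiding_naturality_right_assoc,
    coevaluation_comp_rightAdjointMate_assoc, BraidedCategory.braiding_naturality_left_assoc]

variable [HasCoend (innerHom C)]

/-- The internal cocharacter may be computed from any right dual. -/
theorem cocharacter_eq (X A : C) [ExactPairing X A] :
    cocharacter X = η_ X A ≫ (β_ X A).hom ≫ A ◁ (RibbonCategory.twist X).hom ≫
      pairingDinat (ε_ X A) := by
  rw [cocharacter, rightCoev, pairingDinat, whisker_exchange_assoc,
    ← BraidedCategory.braiding_naturality_right_assoc, ← coevaluation_mate X A]
  simp only [Category.assoc]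

theorem cocharacter_unit : cocharacter (𝟙_ C) = (ρ_ _).inv ≫ pairingDinat (ρ_ (𝟙_ C)).hom := by
  rw [cocharacter_eq (𝟙_ C) (𝟙_ C), twist_unit, MonoidalCategory.whiskerLeft_id,
    Category.id_comp, braiding_tensorUnit_left]
  change (ρ_ _).inv ≫ _ ≫ pairingDinat (ρ_ (𝟙_ C)).hom = _
  rw [unitors_equal]
  simp

/-- The left side is computed with the dual `Yᘁ ⊗ Xᘁ`, whose evaluation and coevaluation are nested
by definition. `twist_tensor` then supplies exactly the double braiding that `nestedCup_braiding`
consumes. -/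
theorem cocharacter_tensor (X Y : C) : cocharacter (X ⊗ Y) =
    (λ_ (𝟙_ C)).inv ≫ (cocharacter X ⊗ₘ cocharacter Y) ≫ coendMul C := by
  have hr : (λ_ (𝟙_ C)).inv ≫ (cocharacter X ⊗ₘ cocharacter Y) ≫ coendMul C =
      (rightCoev Y ⊗≫ (Yᘁ ◁ (rightCoev X ▷ Y)) ⊗≫ 𝟙 _) ≫
        pairingDinat (nestedPairing (ε_ X Xᘁ) (ε_ Y Yᘁ)) := by
    rw [← tensorHom_slideBraid, Category.assoc, Category.assoc, ← pairingDinat_coendMul,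
      pairingDinat_evaluation, pairingDinat_evaluation, tensorHom_comp_tensorHom_assoc]
    rfl
  have hβ : ∀ Z : C, η_ Z Zᘁ ≫ (β_ Z Zᘁ).hom ≫ Zᘁ ◁ (RibbonCategory.twist Z).hom =
      (η_ Z Zᘁ ≫ (RibbonCategory.twist Z).hom ▷ Zᘁ) ≫ (β_ Z Zᘁ).hom := by
    intro Z
    simp
  have hl : η_ (X ⊗ Y) (Yᘁ ⊗ Xᘁ) = nestedCup (η_ X Xᘁ) (η_ Y Yᘁ) := rfl
  have he : ε_ (X ⊗ Y) (Yᘁ ⊗ Xᘁ) = nestedPairing (ε_ X Xᘁ) (ε_ Y Yᘁ) := rfl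
  rw [hr, cocharacter_eq (X ⊗ Y) (Yᘁ ⊗ Xᘁ), rightCoev, rightCoev, hβ, hβ, ← nestedCup_braiding,
    ← nestedCup_comp, hl, he, ← BraidedCategory.braiding_naturality_left_assoc,
    RibbonCategory.twist_tensor]
  simp only [comp_whiskerRight, Category.assoc]

theorem cocharacter_congr {X Y : C} (f : X ≅ Y) : cocharacter X = cocharacter Y := by
  have h := rightCoev_naturality f.hom
  have h2 := dinat_condition f.inv
  calc cocharacter X = (rightCoev X ≫ Xᘁ ◁ f.hom) ≫ Xᘁ ◁ f.inv ≫ dinat X := by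
        simp [cocharacter]
    _ = rightCoev Y ≫ (f.inv ≫ f.hom)ᘁ ▷ Y ≫ dinat Y := by
        rw [h, ← h2, comp_rightAdjointMate]
        simp
    _ = _ := by simp [cocharacter]

theorem defectOperator_congr {X Y : C} (f : X ≅ Y) : defectOperator X = defectOperator Y := by
  rw [defectOperator, defectOperator, cocharacter_congr f]

theorem defectOperator_tensor (X Y : C) :
    defectOperator (X ⊗ Y) = defectOperator X * defectOperator Y := by
  change (λ_ (canonicalCoend C)).inv ≫ cocharacter (X ⊗ Y) ▷ canonicalCoend C ≫ coendMul C =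
    ((λ_ (canonicalCoend C)).inv ≫ cocharacter Y ▷ canonicalCoend C ≫ coendMul C) ≫
    ((λ_ (canonicalCoend C)).inv ≫ cocharacter X ▷ canonicalCoend C ≫ coendMul C)
  have h : (λ_ (canonicalCoend C)).inv ≫ ((λ_ (𝟙_ C)).inv ≫ (cocharacter X ⊗ₘ cocharacter Y)) ▷
      canonicalCoend C ≫ (α_ _ _ _).hom =
      (λ_ (canonicalCoend C)).inv ≫ cocharacter Y ▷ canonicalCoend C ≫ (λ_ _).inv ≫
        cocharacter X ▷ _ := by
    rw [leftUnitor_inv_naturality_assoc, whisker_exchange, MonoidalCategory.tensorHom_def]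
    monoidal
  rw [cocharacter_tensor, ← Category.assoc (λ_ (𝟙_ C)).inv, comp_whiskerRight, Category.assoc,
    coendMul_assoc, reassoc_of% h]
  simp only [Category.assoc]
  rw [leftUnitor_inv_naturality_assoc (coendMul C), whisker_exchange_assoc]

theorem defectOperator_unit : defectOperator (𝟙_ C) = 1 := by
  change (λ_ (canonicalCoend C)).inv ≫ cocharacter (𝟙_ C) ▷ canonicalCoend C ≫ coendMul C = 𝟙 _
  refine canonicalCoend_hom_ext fun X => ?_
  rw [leftUnitor_inv_naturality_assoc, whisker_exchange_assoc, cocharacter_unit,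
    comp_whiskerRight, Category.assoc, ← tensorHom_def_assoc, ← pairingDinat_evaluation,
    pairingDinat_coendMul, reassoc_of% unit_slideBraid]
  have h : 𝟙 (HasRightDual.rightDual X ⊗ X) ⊗≫ HasRightDual.rightDual X ◁ ((ρ_ (𝟙_ C)).inv ▷ X) ⊗≫
      𝟙 ((HasRightDual.rightDual X ⊗ 𝟙_ C) ⊗ (𝟙_ C ⊗ X)) = ((ρ_ _).inv ⊗ₘ (λ_ _).inv) := by
    monoidal
  have h' : ((ρ_ _).inv ⊗ₘ (λ_ _).inv) ≫ nestedPairing (ρ_ (𝟙_ C)).hom (ε_ X Xᘁ) = ε_ X Xᘁ := by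
    simp only [nestedPairing]
    monoidal
  rw [h, pairingDinat_natural, h', Category.comp_id]

/-- A defect operator is determined by its value on the unit element. The right unit law for
cocharacters follows from multiplicativity and `D ⊗ 𝟙 ≅ D`. -/
theorem cocharacter_comp_defectOperator (D : C) :
    cocharacter (𝟙_ C) ≫ (show canonicalCoend C ⟶ canonicalCoend C from defectOperator D) =
      cocharacter D := by
  rw [← cocharacter_congr (ρ_ D), cocharacter_tensor]
  change cocharacter (𝟙_ C) ≫ (λ_ (canonicalCoend C)).inv ≫ cocharacter D ▷ canonicalCoend C ≫
    coendMul C = _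
  rw [leftUnitor_inv_naturality_assoc, whisker_exchange_assoc, ← tensorHom_def_assoc]

end Cocharacters

/-! ### Additivity on short exact sequences. -/

section Additivity

variable {C : Type u} [Category.{v} C] [Abelian C] [MonoidalCategory C] [MonoidalPreadditive C]
  [BraidedCategory C] [RigidCategory C] [HasCoend (innerHom C)] [RibbonCategory C]

/-- As for traces, the coevaluation of the middle term splits into a part from the quotient and a
part from the subobject, and dinaturality moves each part to its own object. The splitting exists
only after pulling back along an epimorphism, since `𝟙` need not be projective. -/
theorem cocharacter_shortExact {S : ShortComplex C} (hS : S.ShortExact) :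
    cocharacter S.X₂ = cocharacter S.X₁ + cocharacter S.X₃ := by
  have h1 := shortExact_whiskerLeft (S.X₁ᘁ) hS
  have h2 := shortExact_whiskerLeft (S.X₂ᘁ) hS
  have h3 := shortExact_whiskerLeft (S.X₃ᘁ) hS
  have : Epi ((S.X₃ᘁ) ◁ S.g) := h3.epi_g
  have : Mono ((S.X₁ᘁ) ◁ S.f) := h1.mono_f
  have : Mono (S.map (tensorLeft (S.X₂ᘁ))).f := h2.mono_f
  have hg := rightCoev_naturality S.g
  have hf := rightCoev_naturality S.f
  -- On this cover the coevaluation of `S.X₃` lifts, through `v`, to `S.X₃ᘁ ⊗ S.X₂`. What then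
  -- remains of the coevaluation of `S.X₂` is killed by `S.g`, so it comes from some `w` into `S.X₂ᘁ
  -- ⊗ S.X₁`.
  let π := pullback.fst (rightCoev S.X₃) ((S.X₃ᘁ) ◁ S.g)
  let v := pullback.snd (rightCoev S.X₃) ((S.X₃ᘁ) ◁ S.g)
  have hπv : π ≫ rightCoev S.X₃ = v ≫ (S.X₃ᘁ) ◁ S.g := pullback.condition
  have hz : (π ≫ rightCoev S.X₂ - v ≫ (S.gᘁ) ▷ S.X₂) ≫ (S.X₂ᘁ) ◁ S.g = 0 := by
    rw [Preadditive.sub_comp, Category.assoc, Category.assoc, hg, ← whisker_exchange,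
      reassoc_of% hπv, sub_self]
  let w : _ ⟶ (S.X₂ᘁ) ⊗ S.X₁ := h2.exact.lift _ hz
  have hw : w ≫ (S.X₂ᘁ) ◁ S.f = π ≫ rightCoev S.X₂ - v ≫ (S.gᘁ) ▷ S.X₂ := h2.exact.lift_f _ hz
  have hfg : S.gᘁ ≫ S.fᘁ = 0 := by
    rw [← comp_rightAdjointMate, S.zero]
    simp [rightAdjointMate]
  -- Tested against the monomorphism `S.X₁ᘁ ◁ S.f`: the term with `v` dies because `S.gᘁ ≫ S.fᘁ =
  -- 0`.
  have hw' : w ≫ (S.fᘁ) ▷ S.X₁ = π ≫ rightCoev S.X₁ := by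
    rw [← cancel_mono ((S.X₁ᘁ) ◁ S.f), Category.assoc, Category.assoc, ← whisker_exchange,
      reassoc_of% hw, hf, Preadditive.sub_comp, Category.assoc, Category.assoc,
      ← comp_whiskerRight, hfg]
    simp
  have e : π ≫ rightCoev S.X₂ = v ≫ (S.gᘁ) ▷ S.X₂ + w ≫ (S.X₂ᘁ) ◁ S.f := by rw [hw]; abel
  rw [← cancel_epi π]
  simp only [cocharacter, Preadditive.comp_add]
  rw [reassoc_of% e, Preadditive.add_comp, Category.assoc, Category.assoc, dinat_condition S.g,
    ← dinat_condition S.f, reassoc_of% hw', reassoc_of% hπv, add_comm]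

theorem defectOperator_shortExact {S : ShortComplex C} (hS : S.ShortExact) :
    defectOperator S.X₂ = defectOperator S.X₁ + defectOperator S.X₃ := by
  simp only [defectOperator]
  rw [cocharacter_shortExact hS, MonoidalPreadditive.add_whiskerRight, Preadditive.add_comp,
    Preadditive.comp_add]

end Additivity

/-! ### The perfect pairing between morphisms from `A` and morphisms to its dual. -/

section Representability

/-- The dual of an algebra `A`, as a left `A`-module. -/
def AlgebraDual (k : Type w) [Field k] (A : Type v) [Ring A] [Algebra k A] : Type (max w v) :=
  Module.Dual k A

namespace AlgebraDual

variable (k : Type w) [Field k] (A : Type v) [Ring A] [Algebra k A]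

instance : AddCommGroup (AlgebraDual k A) := inferInstanceAs (AddCommGroup (Module.Dual k A))

instance : Module k (AlgebraDual k A) := inferInstanceAs (Module k (Module.Dual k A))

instance : Module A (AlgebraDual k A) where
  smul a ψ := LinearMap.comp (show Module.Dual k A from ψ) (LinearMap.mulRight k a)
  one_smul ψ := LinearMap.ext fun x => congrArg (show Module.Dual k A from ψ) (mul_one x)
  mul_smul a b ψ := LinearMap.ext fun x =>
    congrArg (show Module.Dual k A from ψ) (mul_assoc x a b).symm
  smul_zero _ := rfl
  smul_add _ _ _ := rfl
  add_smul a b ψ := LinearMap.ext fun x =>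
    (congrArg (show Module.Dual k A from ψ) (mul_add x a b)).trans (map_add _ _ _)
  zero_smul ψ := LinearMap.ext fun x =>
    (congrArg (show Module.Dual k A from ψ) (mul_zero x)).trans (map_zero _)

variable {k A}

/-- Evaluation of a functional. -/
def eval (ψ : AlgebraDual k A) (x : A) : k := (show Module.Dual k A from ψ) x

theorem ext {ψ φ : AlgebraDual k A} (h : ∀ x, ψ.eval x = φ.eval x) : ψ = φ :=
  LinearMap.ext h

theorem eval_add (ψ φ : AlgebraDual k A) (x : A) : (ψ + φ).eval x = ψ.eval x + φ.eval x := rfl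

theorem eval_smul (a : A) (ψ : AlgebraDual k A) (x : A) : (a • ψ).eval x = ψ.eval (x * a) := rfl

theorem eval_algebraMap_smul (c : k) (ψ : AlgebraDual k A) (x : A) :
    (algebraMap k A c • ψ).eval x = c * ψ.eval x := by
  rw [eval_smul, ← Algebra.commutes, ← Algebra.smul_def]
  exact map_smul (show Module.Dual k A from ψ) c x

variable (k A)

instance : IsScalarTower k A (AlgebraDual k A) :=
  IsScalarTower.of_algebraMap_smul fun c ψ => ext fun x => eval_algebraMap_smul c ψ x

instance [Module.Finite k A] : Module.Finite A (AlgebraDual k A) :=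
  have : Module.Finite k (AlgebraDual k A) := inferInstanceAs (Module.Finite k (Module.Dual k A))
  Module.Finite.of_restrictScalars_finite k A _

/-- The field may live in another universe than `A`. If `A` is nontrivial, `k` embeds in it; if not,
the dual is trivial. Smallness lets the dual be an object of `FGModuleCat.{v} A`. -/
instance : Small.{v} (AlgebraDual k A) := by
  rcases subsingleton_or_nontrivial A with h | h
  · have : Subsingleton (AlgebraDual k A) := ⟨fun ψ φ => ext fun x => by
      rw [Subsingleton.elim x 0]
      exact (map_zero (show Module.Dual k A from ψ)).trans
        (map_zero (show Module.Dual k A from φ)).symm⟩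
    infer_instance
  · have : Small.{v} k := small_of_injective (algebraMap k A).injective
    exact small_of_injective (f := fun (ψ : AlgebraDual k A) (x : A) => ψ.eval x)
      fun ψ φ h => ext (congrFun h)

variable {k A}

/-- Functionals on `M` correspond to module maps from `M` to the dual of the algebra. -/
theorem existsUnique_linearMap {M : Type v} [AddCommGroup M] [Module A M] (φ : M →+ k)
    (hφ : ∀ (c : k) (m : M), φ (algebraMap k A c • m) = c * φ m) :
    ∃! y : M →ₗ[A] AlgebraDual k A, ∀ m, (y m).eval 1 = φ m := by
  let y (m : M) : AlgebraDual k A :=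
    ({ toFun := fun a => φ (a • m)
       map_add' := fun a b => by rw [add_smul, map_add]
       map_smul' := fun c a => by rw [Algebra.smul_def, mul_smul, hφ]; rfl } : Module.Dual k A)
  refine ⟨{ toFun := y
            map_add' := fun m n => ext fun x => ?_
            map_smul' := fun a m => ext fun x => ?_ }, fun m => ?_, fun z hz => ?_⟩
  · change φ (x • (m + n)) = φ (x • m) + φ (x • n)
    rw [smul_add, map_add]
  · change φ (x • (a • m)) = φ ((x * a) • m)
    rw [mul_smul]
  · change φ ((1 : A) • m) = φ m
    rw [one_smul]
  · ext1 m
    refine ext fun x => ?_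
    change _ = φ (x • m)
    rw [← hz, map_smul, eval_smul, one_mul]

end AlgebraDual

/-- For modules take `P = A`, `N` the dual of `A`, and `τ` the evaluation at `1` of the image of
`1`. Then `P ⟶ X` is the module `X` itself and `X ⟶ N` is its space of functionals. -/
theorem exists_perfect_pairing (k : Type w) [Field k] (C : Type u) [Category.{v} C]
    [Preadditive C] [Linear k C] [IsFiniteLinear k C] : ∃ (P N : C) (τ : (P ⟶ N) →ₗ[k] k),
    Projective P ∧ (∀ (X Y : C) (f g : X ⟶ Y), (∀ x : P ⟶ X, x ≫ f = x ≫ g) → f = g) ∧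
    ∀ (X : C) (φ : (P ⟶ X) →ₗ[k] k), ∃! y : X ⟶ N, ∀ x : P ⟶ X, τ (x ≫ y) = φ x := by
  obtain ⟨A, _, _, hA, e, _, _⟩ := IsFiniteLinear.exists_equivalence (k := k) (C := C)
  let D := Shrink.{v} (AlgebraDual k A)
  let s : D ≃ₗ[A] AlgebraDual k A := Shrink.linearEquiv A (AlgebraDual k A)
  have : Module.Finite A D := Module.Finite.equiv s.symm
  let P := e.inverse.obj (FGModuleCat.of A A)
  let N := e.inverse.obj (FGModuleCat.of A D)
  let a : e.functor.obj P ≅ FGModuleCat.of A A := e.counitIso.app _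
  let b : e.functor.obj N ≅ FGModuleCat.of A D := e.counitIso.app _
  let p : e.functor.obj P := a.inv.hom.hom (1 : A)
  let ev {X : C} (x : P ⟶ X) : e.functor.obj X := (e.functor.map x).hom.hom p
  have ev_comp {X Y : C} (x : P ⟶ X) (f : X ⟶ Y) :
      ev (x ≫ f) = (e.functor.map f).hom.hom (ev x) := by
    simp only [ev, Functor.map_comp]
    rfl
  have ev_add {X : C} (x y : P ⟶ X) : ev (x + y) = ev x + ev y := by
    simp only [ev, Functor.map_add]
    rfl
  have ev_smul {X : C} (c : k) (x : P ⟶ X) : ev (c • x) = algebraMap k A c • ev x := by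
    simp only [ev, Functor.map_smul]
    rfl
  have ev_bij (X : C) : Function.Bijective (ev (X := X)) := by
    refine ⟨fun x y h => e.functor.map_injective ?_, fun m => ?_⟩
    · rw [← cancel_epi a.inv]
      ext1
      exact LinearMap.ext_ring h
    · refine ⟨e.functor.preimage (a.hom ≫ FGModuleCat.ofHom (LinearMap.toSpanSingleton A _ m)), ?_⟩
      simp only [ev, Functor.map_preimage]
      change LinearMap.toSpanSingleton A _ m ((a.inv ≫ a.hom).hom.hom 1) = m
      rw [a.inv_hom_id]
      exact one_smul A m
  let t (n : e.functor.obj N) : k := (s (b.hom.hom.hom n)).eval 1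
  let τ : (P ⟶ N) →ₗ[k] k :=
    { toFun := fun f => t (ev f)
      map_add' := fun f g => by
        simp only [t, ev_add, map_add, AlgebraDual.eval_add]
      map_smul' := fun c f => by
        simp only [t, ev_smul, map_smul, AlgebraDual.eval_algebraMap_smul, RingHom.id_apply,
          smul_eq_mul] }
  refine ⟨P, N, τ, (e.symm.map_projective_iff _).2 fg_projective, fun X Y f g h => ?_,
    fun X φ => ?_⟩
  · apply e.functor.map_injective
    ext1
    refine LinearMap.ext fun m => ?_
    obtain ⟨x, rfl⟩ := (ev_bij X).2 m
    rw [← ev_comp, ← ev_comp, h]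
  · let ι := Equiv.ofBijective _ (ev_bij X)
    have hι (x : P ⟶ X) : ι.symm (ev x) = x := ι.symm_apply_apply x
    let φ' : e.functor.obj X →+ k :=
      { toFun := fun m => φ (ι.symm m)
        map_zero' := by
          obtain ⟨x, hx⟩ := (ev_bij X).2 0
          have h0 : ev (0 : P ⟶ X) = 0 := by simpa using ev_smul (0 : k) (0 : P ⟶ X)
          rw [← h0, hι, map_zero]
        map_add' := fun m n => by
          obtain ⟨x, rfl⟩ := (ev_bij X).2 m
          obtain ⟨y, rfl⟩ := (ev_bij X).2 n
          rw [← ev_add, hι, hι, hι, map_add] }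
    have hφ' (c : k) (m : e.functor.obj X) : φ' (algebraMap k A c • m) = c * φ' m := by
      obtain ⟨x, rfl⟩ := (ev_bij X).2 m
      change φ (ι.symm _) = c * φ (ι.symm _)
      rw [← ev_smul, hι, hι, map_smul, smul_eq_mul]
    obtain ⟨y, hy, hy'⟩ := AlgebraDual.existsUnique_linearMap φ' hφ'
    refine ⟨e.functor.preimage (FGModuleCat.ofHom (s.symm.toLinearMap ∘ₗ y) ≫ b.inv),
      fun x => ?_, fun z hz => ?_⟩
    · change t (ev (x ≫ _)) = φ x
      rw [ev_comp, Functor.map_preimage]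
      change (s ((b.inv ≫ b.hom).hom.hom (s.symm (y (ev x))))).eval 1 = _
      rw [b.inv_hom_id]
      change (s (s.symm (y (ev x)))).eval 1 = _
      rw [LinearEquiv.apply_symm_apply, hy]
      exact congrArg φ (hι x)
    · have h := hy' (s.toLinearMap ∘ₗ (e.functor.map z ≫ b.hom).hom.hom) fun m => by
        obtain ⟨x, rfl⟩ := (ev_bij X).2 m
        refine Eq.trans ?_ ((hz x).trans (congrArg φ (hι x)).symm)
        change _ = t (ev (x ≫ z))
        rw [ev_comp]
        rfl
      apply e.functor.map_injective
      rw [Functor.map_preimage, Iso.eq_comp_inv]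
      ext1
      refine LinearMap.ext fun m => ?_
      refine s.injective ?_
      refine (LinearMap.congr_fun h m).trans ?_
      exact (s.apply_symm_apply _).symm

end Representability

/-! ### Linear independence of families of morphisms to and from simple objects. -/

section Semisimple

variable {C : Type u} [Category.{v} C] [Abelian C] {σ : Type*} {S : σ → C} [∀ i, Simple (S i)]

/-- A nonzero `g j` is a monomorphism. By induction the other `g i` vanish modulo its image, so all
of them factor through `S j`, which is the case assumed in `hx`. It will show that the map from `P`
to a sum of simples is epi; the next lemma is the dual statement. -/
theorem eq_zero_of_sum_comp_eq_zero {P : C} (x : ∀ i, P ⟶ S i)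
    (hx : ∀ (s : Finset σ) (j : σ) (u : ∀ i, S i ⟶ S j), ∑ i ∈ s, x i ≫ u i = 0 →
      ∀ i ∈ s, u i = 0) (s : Finset σ) {Z : C} (g : ∀ i, S i ⟶ Z)
    (hg : ∑ i ∈ s, x i ≫ g i = 0) : ∀ i ∈ s, g i = 0 := by
  classical
  induction s using Finset.induction_on generalizing Z with
  | empty => simp
  | insert j s hj ih =>
    by_cases h0 : g j = 0
    · rw [Finset.sum_insert hj, h0, comp_zero, zero_add] at hg
      intro i hi
      rcases Finset.mem_insert.1 hi with rfl | hi
      · exact h0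
      · exact ih g hg i hi
    · exfalso
      have := mono_of_nonzero_from_simple h0
      have hq : ∀ i ∈ s, g i ≫ cokernel.π (g j) = 0 := by
        refine ih (fun i => g i ≫ cokernel.π (g j)) ?_
        have := congrArg (· ≫ cokernel.π (g j)) hg
        simpa [Finset.sum_insert hj, Preadditive.sum_comp] using this
      have hu : ∀ i, ∃ u : S i ⟶ S j, i ∈ insert j s → u ≫ g j = g i := by
        intro i
        by_cases hi : i ∈ insert j s
        · have hz : g i ≫ cokernel.π (g j) = 0 := by
            rcases Finset.mem_insert.1 hi with rfl | hi
            · exact cokernel.condition _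
            · exact hq i hi
          exact ⟨Abelian.monoLift (g j) (g i) hz, fun _ => Abelian.monoLift_comp _ _ _⟩
        · exact ⟨0, fun h => absurd h hi⟩
      choose u hu using hu
      have hsum : ∑ i ∈ insert j s, x i ≫ u i = 0 := by
        rw [← cancel_mono (g j), Preadditive.sum_comp, zero_comp, ← hg]
        exact Finset.sum_congr rfl fun i hi => by rw [Category.assoc, hu i hi]
      have := hu j (Finset.mem_insert_self j s)
      rw [hx _ j u hsum j (Finset.mem_insert_self j s), zero_comp] at this
      exact h0 this.symm

theorem eq_zero_of_comp_sum_eq_zero {N : C} (y : ∀ i, S i ⟶ N)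
    (hy : ∀ (s : Finset σ) (j : σ) (u : ∀ i, S j ⟶ S i), ∑ i ∈ s, u i ≫ y i = 0 →
      ∀ i ∈ s, u i = 0) (s : Finset σ) {Z : C} (g : ∀ i, Z ⟶ S i)
    (hg : ∑ i ∈ s, g i ≫ y i = 0) : ∀ i ∈ s, g i = 0 := by
  classical
  induction s using Finset.induction_on generalizing Z with
  | empty => simp
  | insert j s hj ih =>
    by_cases h0 : g j = 0
    · rw [Finset.sum_insert hj, h0, zero_comp, zero_add] at hg
      intro i hi
      rcases Finset.mem_insert.1 hi with rfl | hi
      · exact h0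
      · exact ih g hg i hi
    · exfalso
      have := epi_of_nonzero_to_simple h0
      have hq : ∀ i ∈ s, kernel.ι (g j) ≫ g i = 0 := by
        refine ih (fun i => kernel.ι (g j) ≫ g i) ?_
        have := congrArg (kernel.ι (g j) ≫ ·) hg
        simpa [Finset.sum_insert hj, Preadditive.comp_sum] using this
      have hu : ∀ i, ∃ u : S j ⟶ S i, i ∈ insert j s → g j ≫ u = g i := by
        intro i
        by_cases hi : i ∈ insert j s
        · have hz : kernel.ι (g j) ≫ g i = 0 := by
            rcases Finset.mem_insert.1 hi with rfl | hi
            · exact kernel.condition _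
            · exact hq i hi
          exact ⟨Abelian.epiDesc (g j) (g i) hz, fun _ => Abelian.comp_epiDesc _ _ _⟩
        · exact ⟨0, fun h => absurd h hi⟩
      choose u hu using hu
      have hsum : ∑ i ∈ insert j s, u i ≫ y i = 0 := by
        rw [← cancel_epi (g j), Preadditive.comp_sum, comp_zero, ← hg]
        exact Finset.sum_congr rfl fun i hi => by rw [← Category.assoc, hu i hi]
      have := hu j (Finset.mem_insert_self j s)
      rw [hy _ j u hsum j (Finset.mem_insert_self j s), comp_zero] at this
      exact h0 this.symm

end Semisimple

/-! ### Dual bases and Casimir natural transformations. -/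

section PerfectPairing

variable {k : Type w} [Field k] {C : Type u} [Category.{v} C] [Preadditive C] [Linear k C]
  {P N : C}

/-- A functional on `P ⟶ N` for which composition `(P ⟶ X) × (X ⟶ N) → k` is a perfect pairing for
every `X`. -/
def IsPerfect (τ : (P ⟶ N) →ₗ[k] k) : Prop :=
  ∀ (X : C) (φ : (P ⟶ X) →ₗ[k] k), ∃! y : X ⟶ N, ∀ x : P ⟶ X, τ (x ≫ y) = φ x

variable {τ : (P ⟶ N) →ₗ[k] k}

theorem IsPerfect.ext (hτ : IsPerfect τ) {X : C} {y z : X ⟶ N}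
    (h : ∀ x : P ⟶ X, τ (x ≫ y) = τ (x ≫ z)) : y = z :=
  (hτ X (τ ∘ₗ Linear.rightComp k P z)).unique h fun _ => rfl

/-- Morphisms to `N` are functionals on `P ⟶ X`, and a functional extends along an injective linear
map of vector spaces. -/
theorem IsPerfect.injective (hτ : IsPerfect τ) : Injective N where
  factors {X Y} g f _ := by
    obtain ⟨l, hl⟩ := (Linear.rightComp k P f).exists_leftInverse_of_injective
      (LinearMap.ker_eq_bot.2 fun x y h => (cancel_mono f).1 h)
    obtain ⟨y, hy, -⟩ := hτ Y (τ ∘ₗ Linear.rightComp k P g ∘ₗ l)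
    refine ⟨y, hτ.ext fun x => ?_⟩
    rw [← Category.assoc, hy]
    exact congrArg (fun z => τ (z ≫ g)) (LinearMap.congr_fun hl x)

/-- The element of `X ⟶ N` representing the `a`-th coordinate on `P ⟶ X`. -/
noncomputable def IsPerfect.dualVec (hτ : IsPerfect τ) {X : C} {ι : Type*}
    (b : Module.Basis ι k (P ⟶ X)) (a : ι) :
    X ⟶ N :=
  (hτ X (b.coord a)).choose

theorem IsPerfect.comp_dualVec (hτ : IsPerfect τ) {X : C} {ι : Type*}
    (b : Module.Basis ι k (P ⟶ X)) (a : ι)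
    (x : P ⟶ X) : τ (x ≫ hτ.dualVec b a) = b.repr x a :=
  (hτ X (b.coord a)).choose_spec.1 x

/-- The morphism `∑ₐ yₐ ≫ h ≫ F(xₐ)` for dual bases `xₐ` of `P ⟶ X` and `yₐ` of `X ⟶ N`. -/
noncomputable def IsPerfect.casimir (hτ : IsPerfect τ)
    (F : C ⥤ C) (h : N ⟶ F.obj P) {X : C} {ι : Type*} [Fintype ι]
    (b : Module.Basis ι k (P ⟶ X)) : X ⟶ F.obj X :=
  ∑ a, hτ.dualVec b a ≫ h ≫ F.map (b a)

/-- A morphism `f` acts on the spaces `P ⟶ X` by a matrix and on their duals by the transpose, so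
both sides are the same double sum. -/
theorem IsPerfect.casimir_natural (hτ : IsPerfect τ) (F : C ⥤ C) [F.Additive] [F.Linear k]
    (h : N ⟶ F.obj P)
    {X Y : C} {ι κ : Type*} [Fintype ι] [Fintype κ] (b : Module.Basis ι k (P ⟶ X))
    (c : Module.Basis κ k (P ⟶ Y)) (f : X ⟶ Y) :
    f ≫ hτ.casimir F h c = hτ.casimir F h b ≫ F.map f := by
  have h1 (j : κ) : f ≫ hτ.dualVec c j = ∑ a, (c.repr (b a ≫ f) j) • hτ.dualVec b a := by
    refine hτ.ext fun x => ?_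
    rw [← Category.assoc, hτ.comp_dualVec, Preadditive.comp_sum, map_sum]
    simp only [Linear.comp_smul, map_smul, hτ.comp_dualVec]
    have e : x ≫ f = ∑ a, b.repr x a • (b a ≫ f) := by
      conv_lhs => rw [← b.sum_repr x]
      simp only [Preadditive.sum_comp, Linear.smul_comp]
    rw [e]
    simp [mul_comm]
  have h2 (a : ι) : b a ≫ f = ∑ j, (c.repr (b a ≫ f) j) • c j := (c.sum_repr _).symm
  simp only [IsPerfect.casimir, Preadditive.comp_sum, Preadditive.sum_comp, Category.assoc,
    ← F.map_comp]
  simp only [reassoc_of% h1, Preadditive.sum_comp]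
  rw [Finset.sum_comm]
  refine Finset.sum_congr rfl fun a _ => ?_
  have e : F.map (b a ≫ f) = ∑ j, (c.repr (b a ≫ f) j) • F.map (c j) := by
    conv_lhs => rw [h2 a]
    simp only [Functor.map_sum, Functor.map_smul]
  rw [e]
  simp only [Preadditive.comp_sum, Linear.comp_smul, Linear.smul_comp]

end PerfectPairing

/-! ### Natural transformations with prescribed values on simple objects. -/

section Extension

/-- `X ⊗ -` is right adjoint to `Xᘁ ⊗ -`, which preserves monomorphisms because it is itself a right
adjoint. -/
theorem injective_tensor {C : Type u} [Category.{v} C] [MonoidalCategory C] [RigidCategory C]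
    (X I : C) [hI : Injective I] : Injective (X ⊗ I) := by
  have := (tensorLeft (Xᘁ)).preservesMonomorphisms_of_adjunction
    (tensorLeftAdjunction Xᘁ (HasRightDual.rightDual (HasRightDual.rightDual X)))
  exact (tensorLeftAdjunction X Xᘁ).map_injective I hI

variable {C : Type u} [Category.{v} C] [Abelian C] [MonoidalCategory C] [MonoidalPreadditive C]
  [RigidCategory C]

theorem shortExact_whiskerRight (X : C) {S : ShortComplex C} (hS : S.ShortExact) :
    (S.map (tensorRight X)).ShortExact := by
  have h3 := (tensorRightAdjunction X Xᘁ).leftAdjoint_preservesColimits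
  have h4 := (tensorRightAdjunction (ᘁX) X).rightAdjoint_preservesLimits
  exact hS.map_of_exact (tensorRight X)

/-- The kernel of `p ▷ I` is `kernel p ⊗ I`, which is injective. So `p ▷ I` has a section, without
any projectivity of `N`. -/
theorem exists_comp_whiskerRight {P T I N : C} [Injective I] (p : P ⟶ T) [Epi p] (t : N ⟶ T ⊗ I) :
    ∃ h : N ⟶ P ⊗ I, h ≫ p ▷ I = t := by
  have hS : (ShortComplex.mk (kernel.ι p) p (kernel.condition p)).ShortExact :=
    { exact := ShortComplex.exact_kernel p }
  have hI := shortExact_whiskerRight I hS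
  have : Injective ((ShortComplex.mk (kernel.ι p) p (kernel.condition p)).map (tensorRight I)).X₁ :=
    injective_tensor (kernel p) I
  refine ⟨t ≫ hI.splittingOfInjective.s, ?_⟩
  refine (Category.assoc t _ _).trans ?_
  exact (congrArg (t ≫ ·) hI.splittingOfInjective.s_g).trans (Category.comp_id t)

theorem lift_comp_eq_sum {D : Type u} [Category.{v} D] [Preadditive D] [HasFiniteBiproducts D]
    {σ : Type*} [Fintype σ] {S : σ → D} {P Z : D} (x : ∀ i, P ⟶ S i) (g : ⨁ S ⟶ Z) :
    biproduct.lift x ≫ g = ∑ i, x i ≫ biproduct.ι S i ≫ g := by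
  classical
  have h : biproduct.lift x = ∑ i, x i ≫ biproduct.ι S i := by
    ext j
    simp [Preadditive.sum_comp, biproduct.ι_π, comp_dite]
  rw [h, Preadditive.sum_comp]
  simp only [Category.assoc]

theorem comp_desc_eq_sum {D : Type u} [Category.{v} D] [Preadditive D] [HasFiniteBiproducts D]
    {σ : Type*} [Fintype σ] {S : σ → D} {N Z : D} (y : ∀ i, S i ⟶ N) (g : Z ⟶ ⨁ S) :
    g ≫ biproduct.desc y = ∑ i, (g ≫ biproduct.π S i) ≫ y i := by
  classical
  have h : biproduct.desc y = ∑ i, biproduct.π S i ≫ y i := by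
    ext j
    simp [Preadditive.comp_sum, biproduct.ι_π_assoc, dite_comp]
  rw [h, Preadditive.comp_sum]
  simp only [Category.assoc]

theorem exists_natural_extension (k : Type w) [Field k] [IsAlgClosed k] [Linear k C]
    [MonoidalLinear k C] [IsFiniteLinear k C] (I : C) [Injective I] {J : Type*} [Finite J]
    (S : J → C) [∀ j, Simple (S j)] (hS : ∀ i j, i ≠ j → IsEmpty (S i ≅ S j)) (j₀ : J)
    (f₀ : S j₀ ⟶ S j₀ ⊗ I) : ∃ η : ∀ X : C, X ⟶ X ⊗ I,
      (∀ {X Y : C} (f : X ⟶ Y), f ≫ η Y = η X ≫ f ▷ I) ∧ η (S j₀) = f₀ ∧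
        ∀ j, j ≠ j₀ → η (S j) = 0 := by
  classical
  have := Fintype.ofFinite J
  have := Abelian.hasFiniteBiproducts (C := C)
  have := finite_hom k (C := C)
  obtain ⟨P, N, τ, -, hP, hτ⟩ := exists_perfect_pairing k C
  replace hτ : IsPerfect τ := hτ
  have := hτ.injective
  let b (X : C) : Module.Basis _ k (P ⟶ X) := Module.finBasis k (P ⟶ X)
  -- Each `S j` is repeated as often as the dimension of `P ⟶ S j`, with `x` running through a basis
  -- and `y` through the dual basis. Schur's lemma then gives the independence `hx` and `hy'`, so `⨁
  -- S'` is a quotient of `P` and a subobject of `N`.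
  let σ := Σ j, Fin (Module.finrank k (P ⟶ S j))
  let S' : σ → C := fun i => S i.1
  let x (i : σ) : P ⟶ S' i := b (S i.1) i.2
  let y (i : σ) : S' i ⟶ N := hτ.dualVec (b (S i.1)) i.2
  have hne {i j : J} (h : i ≠ j) (f : S i ⟶ S j) : f = 0 := by
    by_contra hf
    have := isIso_of_hom_simple hf
    exact (hS i j h).false (asIso f)
  have hy (i : σ) (z : P ⟶ S' i) : τ (z ≫ y i) = (b (S i.1)).repr z i.2 := hτ.comp_dualVec _ _ _
  have hx : ∀ (s : Finset σ) (j : σ) (u : ∀ i, S' i ⟶ S' j), ∑ i ∈ s, x i ≫ u i = 0 →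
      ∀ i ∈ s, u i = 0 := by
    rintro s ⟨j, _⟩ u hu ⟨l, a⟩ hi
    rcases eq_or_ne l j with rfl | hij
    swap
    · exact hne hij (u ⟨l, a⟩)
    obtain ⟨c, hc⟩ := endomorphism_simple_eq_smul_id k (u ⟨l, a⟩)
    have key : (b (S l)).repr (∑ i ∈ s, x i ≫ u i) a = c := by
      rw [map_sum, Finsupp.finsetSum_apply, Finset.sum_eq_single_of_mem ⟨l, a⟩ hi]
      · rw [← hc]
        simp [x, S']
      · rintro ⟨m, a'⟩ _ hm
        rcases eq_or_ne m l with rfl | hml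
        · obtain ⟨c', hc'⟩ := endomorphism_simple_eq_smul_id k (u ⟨m, a'⟩)
          have : a' ≠ a := fun h => hm (by rw [h])
          rw [← hc']
          simp [x, S', this]
        · rw [hne hml (u ⟨m, a'⟩)]
          simp
    rw [← hc, ← key, hu]
    simp
  have hy' : ∀ (s : Finset σ) (j : σ) (u : ∀ i, S' j ⟶ S' i), ∑ i ∈ s, u i ≫ y i = 0 →
      ∀ i ∈ s, u i = 0 := by
    rintro s ⟨j, _⟩ u hu ⟨l, a⟩ hi
    rcases eq_or_ne l j with rfl | hij
    swap
    · exact hne hij.symm (u ⟨l, a⟩)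
    obtain ⟨c, hc⟩ := endomorphism_simple_eq_smul_id k (u ⟨l, a⟩)
    have key : τ (b (S l) a ≫ ∑ i ∈ s, u i ≫ y i) = c := by
      rw [Preadditive.comp_sum, map_sum, Finset.sum_eq_single_of_mem ⟨l, a⟩ hi]
      · rw [← Category.assoc, hy, ← hc]
        simp [S']
      · rintro ⟨m, a'⟩ _ hm
        rw [← Category.assoc, hy]
        rcases eq_or_ne m l with rfl | hml
        · obtain ⟨c', hc'⟩ := endomorphism_simple_eq_smul_id k (u ⟨m, a'⟩)
          have : a ≠ a' := fun h => hm (by rw [h])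
          rw [← hc']
          simp [S', this]
        · rw [hne hml.symm (u ⟨m, a'⟩)]
          simp
    rw [← hc, ← key, hu]
    simp
  let p : P ⟶ ⨁ S' := biproduct.lift x
  let q : ⨁ S' ⟶ N := biproduct.desc y
  have hp : Epi p := Preadditive.epi_of_cancel_zero _ fun {Z} g hg => by
    refine biproduct.hom_ext' _ _ fun i => ?_
    rw [comp_zero]
    refine eq_zero_of_sum_comp_eq_zero x hx Finset.univ (fun i => biproduct.ι S' i ≫ g) ?_ i
      (Finset.mem_univ i)
    exact (lift_comp_eq_sum x g).symm.trans hg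
  have hq : Mono q := Preadditive.mono_of_cancel_zero _ fun {Z} g hg => by
    refine biproduct.hom_ext _ _ fun i => ?_
    rw [zero_comp]
    refine eq_zero_of_comp_sum_eq_zero y hy' Finset.univ (fun i => g ≫ biproduct.π S' i) ?_ i
      (Finset.mem_univ i)
    exact (comp_desc_eq_sum y g).symm.trans hg
  have hpos : 0 < Module.finrank k (P ⟶ S j₀) := by
    rw [Module.finrank_pos_iff]
    by_contra h
    rw [not_nontrivial_iff_subsingleton] at h
    exact id_nonzero (S j₀) (hP _ _ _ _ fun z => Subsingleton.elim _ _)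
  let i₀ : σ := ⟨j₀, ⟨0, hpos⟩⟩
  have := injective_tensor (⨁ S') I
  -- A matrix unit: `f₀` from one copy of `S j₀` to the same copy, zero elsewhere. Since `(⨁ S') ⊗
  -- I` is injective, `t` extends along `q` to `N`, and the extension lifts through `p ▷ I` to `h`.
  -- In the Casimir sum of `h` on a simple object only the summand of that one copy survives.
  let t : ⨁ S' ⟶ (⨁ S') ⊗ I := biproduct.π S' i₀ ≫ f₀ ≫ biproduct.ι S' i₀ ▷ I
  obtain ⟨h, hh⟩ := exists_comp_whiskerRight p (Injective.factorThru t q)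
  have hqh : q ≫ h ≫ p ▷ I = t := by rw [hh, Injective.comp_factorThru]
  let F := tensorRight I
  have : F.Linear k := { map_smul := fun f c => by simp [F] }
  have hterm (i : σ) : y i ≫ h ≫ x i ▷ I =
      (biproduct.ι S' i ≫ biproduct.π S' i₀) ≫ f₀ ≫ (biproduct.ι S' i₀ ≫ biproduct.π S' i) ▷ I := by
    have hxi : x i = p ≫ biproduct.π S' i := by simp [p]
    have hyi : y i = biproduct.ι S' i ≫ q := by simp [q]
    rw [hxi, hyi, comp_whiskerRight, Category.assoc, reassoc_of% hqh]
    simp [t]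
  refine ⟨fun X => hτ.casimir F h (b X), fun f => hτ.casimir_natural F h _ _ f, ?_, fun j hj => ?_⟩
  · change ∑ a, y ⟨j₀, a⟩ ≫ h ≫ x ⟨j₀, a⟩ ▷ I = f₀
    rw [Finset.sum_eq_single ⟨0, hpos⟩]
    · rw [hterm ⟨j₀, ⟨0, hpos⟩⟩]
      change (biproduct.ι S' i₀ ≫ biproduct.π S' i₀) ≫ f₀ ≫
        (biproduct.ι S' i₀ ≫ biproduct.π S' i₀) ▷ I = f₀
      rw [biproduct.ι_π_self, Category.id_comp, id_whiskerRight]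
      exact Category.comp_id f₀
    · intro a _ ha
      rw [hterm, biproduct.ι_π_ne, zero_comp]
      exact fun h => ha (eq_of_heq (Sigma.mk.inj h).2)
    · simp
  · refine Finset.sum_eq_zero fun a _ => (hterm ⟨j, a⟩).trans ?_
    rw [biproduct.ι_π_ne, zero_comp]
    exact fun h => hj (congrArg Sigma.fst h)

end Extension

/-! ### Linear independence of the cocharacters of simple objects. -/

section Independence

/-- Hence every natural transformation `X ⟶ X ⊗ I` defines a morphism from the coend to `I`. -/
theorem dinatural_of_natural {C : Type u} [Category.{v} C] [MonoidalCategory C] [RigidCategory C]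
    {I : C} (η : ∀ X : C, X ⟶ X ⊗ I)
    (hη : ∀ {X Y : C} (f : X ⟶ Y), f ≫ η Y = η X ≫ f ▷ I) ⦃X Y : C⦄ (f : X ⟶ Y) :
    fᘁ ▷ X ≫ (tensorLeftHomEquiv X X Xᘁ I).symm (η X) =
      Yᘁ ◁ f ≫ (tensorLeftHomEquiv Y Y Yᘁ I).symm (η Y) := by
  rw [← tensorLeftHomEquiv_symm_naturality, hη]
  simp only [tensorLeftHomEquiv, Equiv.coe_fn_symm_mk]
  rw [← whisker_exchange_assoc, associator_inv_naturality_left_assoc,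
    ← comp_whiskerRight_assoc, rightAdjointMate_comp_evaluation]
  simp

theorem exists_mono_to_injective (k : Type w) [Field k] {C : Type u} [Category.{v} C] [Abelian C]
    [Linear k C] [IsFiniteLinear k C] (X : C) [Simple X] :
    ∃ (I : C) (j : X ⟶ I), Injective I ∧ Mono j := by
  obtain ⟨P, N, τ, -, hP, hτ⟩ := exists_perfect_pairing k C
  replace hτ : IsPerfect τ := hτ
  obtain ⟨x, hx⟩ : ∃ x : P ⟶ X, x ≠ 0 := by
    by_contra! h
    exact id_nonzero X (hP _ _ _ _ fun x => by rw [h x, zero_comp, zero_comp])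
  obtain ⟨φ, hφ⟩ : ∃ φ : Module.Dual k (P ⟶ X), φ x ≠ 0 := by
    by_contra! h
    exact hx ((Module.forall_dual_apply_eq_zero_iff k x).1 h)
  obtain ⟨y, hy, -⟩ := hτ X φ
  refine ⟨N, y, hτ.injective, mono_of_nonzero_from_simple fun h => hφ ?_⟩
  rw [← hy, h, comp_zero, map_zero]

variable {C : Type u} [Category.{v} C] [Abelian C] [MonoidalCategory C] [MonoidalPreadditive C]
  [RigidCategory C] [BraidedCategory C] [RibbonCategory C]

/-- Twist and braiding are invertible, so the coevaluation itself would vanish, and the snake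
identity would make the identity of `S` zero. -/
theorem rightCoev_ne_zero (S : C) [Simple S] : rightCoev S ≠ 0 := by
  intro h
  have hη : η_ S Sᘁ = 0 := by
    rw [rightCoev, ← Category.assoc] at h
    have h2 := zero_of_comp_mono _ h
    exact zero_of_comp_mono _ h2
  have h3 := ExactPairing.evaluation_coevaluation S Sᘁ
  rw [hη, MonoidalPreadditive.zero_whiskerRight, zero_comp] at h3
  refine id_nonzero S ?_
  rw [← cancel_epi (λ_ S).hom, ← cancel_mono (ρ_ S).inv, Category.assoc, Category.id_comp, ← h3,
    comp_zero, zero_comp]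

variable [HasCoend (innerHom C)]

theorem eq_zero_of_sum_cocharacter_eq_zero (k : Type w) [Field k] [IsAlgClosed k] [Linear k C]
    [MonoidalLinear k C] [IsFiniteTensorCategory k C] {J : Type*} [Fintype J] (S : J → C)
    [∀ j, Simple (S j)] (hS : ∀ i j, i ≠ j → IsEmpty (S i ≅ S j)) (c : J → k)
    (hc : ∑ j, c j • cocharacter (S j) = 0) (j : J) : c j = 0 := by
  have := IsFiniteTensorCategory.simple_unit k (C := C)
  obtain ⟨I, u, _, _⟩ := exists_mono_to_injective k (𝟙_ C)
  have : Mono (rightCoev (S j)) := mono_of_nonzero_from_simple (rightCoev_ne_zero (S j))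
  -- Chosen so that `rightCoev (S j) ≫ e = u`. The morphism `d` built from it sends the `j`-th
  -- cocharacter to `u` and the others to zero.
  let e : (S j)ᘁ ⊗ S j ⟶ I := Injective.factorThru u (rightCoev (S j))
  obtain ⟨η, hη, hj, hi⟩ := exists_natural_extension k I S hS j
    (tensorLeftHomEquiv (S j) (S j) (S j)ᘁ I e)
  let d : canonicalCoend C ⟶ I := coendDesc _ (dinatural_of_natural η hη)
  have hd (X : C) : cocharacter X ≫ d =
      rightCoev X ≫ (tensorLeftHomEquiv X X Xᘁ I).symm (η X) := by
    rw [cocharacter, Category.assoc, dinat_coendDesc]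
  have h := congrArg (· ≫ d) hc
  simp only [Preadditive.sum_comp, Linear.smul_comp, zero_comp, hd] at h
  rw [Finset.sum_eq_single j, hj, Equiv.symm_apply_apply, Injective.comp_factorThru] at h
  · have hu : u ≠ 0 := fun h0 => id_nonzero (𝟙_ C) (by rw [← cancel_mono u, h0]; simp)
    exact (smul_eq_zero.1 h).resolve_right hu
  · intro i _ hij
    rw [hi i hij]
    simp [tensorLeftHomEquiv]
  · simp

end Independence

/-! ### Generators of the linearised Grothendieck ring. -/

section Generation

variable {C : Type u} [Category.{v} C] [Abelian C] [MonoidalCategory C]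
  [MonoidalPreadditive C] [BraidedCategory C] [RigidCategory C]

theorem grothendieckClass_shortExact {S : ShortComplex C} (hS : S.ShortExact) :
    grothendieckClass C S.X₂ = grothendieckClass C S.X₁ + grothendieckClass C S.X₃ := by
  rw [← sub_eq_zero, ← sub_sub]
  simp only [grothendieckClass]
  rw [← map_sub, ← map_sub, Ideal.Quotient.eq_zero_iff_mem]
  exact AddSubgroup.subset_closure ⟨S, hS, rfl⟩

theorem grothendieckClass_congr {X Y : C} (e : X ≅ Y) :
    grothendieckClass C X = grothendieckClass C Y := by
  rw [grothendieckClass, grothendieckClass, congr_toSkeleton_of_iso e]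

/-- The span of the classes of simple objects contains the class of every object. -/
theorem tmul_grothendieckClass_mem_span (k : Type w) [Field k] [Linear k C] [IsFiniteLinear k C]
    (X : C) : (1 : k) ⊗ₜ[ℤ] grothendieckClass C X ∈
      Submodule.span k {x : LinearGrothendieckRing C k |
        ∃ S : C, Simple S ∧ x = (1 : k) ⊗ₜ[ℤ] grothendieckClass C S} := by
  have := finite_hom k (C := C)
  obtain ⟨P, N, τ, _, hP, -⟩ := exists_perfect_pairing k C
  have hpos {Y : C} (hY : ¬ IsZero Y) : 0 < Module.finrank k (P ⟶ Y) := by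
    rw [Module.finrank_pos_iff]
    by_contra h
    rw [not_nontrivial_iff_subsingleton] at h
    exact hY ((IsZero.iff_id_eq_zero Y).2 (hP _ _ _ _ fun z => Subsingleton.elim _ _))
  -- The dimension of `P ⟶ X` plays the role of length: it is additive because `P` is projective and
  -- positive on nonzero objects because `P` is a generator.
  induction hn : Module.finrank k (P ⟶ X) using Nat.strong_induction_on generalizing X with
  | _ n ih =>
    by_cases h0 : IsZero X
    -- For a zero object this sequence gives `[X] = [X] + [X]`.
    · have hS : (ShortComplex.mk (0 : X ⟶ X) (0 : X ⟶ X) (by simp)).ShortExact :=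
        { exact := ShortComplex.exact_of_isZero_X₂ _ h0
          mono_f := ⟨fun _ _ _ => h0.eq_of_tgt _ _⟩
          epi_g := ⟨fun _ _ _ => h0.eq_of_src _ _⟩ }
      have h1 : grothendieckClass C X = 0 := by simpa using grothendieckClass_shortExact hS
      rw [h1, TensorProduct.tmul_zero]
      exact Submodule.zero_mem _
    by_cases hX : Simple X
    · exact Submodule.subset_span ⟨X, hX, rfl⟩
    obtain ⟨Y, f, _, hf0, hf⟩ : ∃ (Y : C) (f : Y ⟶ X), Mono f ∧ f ≠ 0 ∧ ¬ IsIso f := by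
      by_contra! h
      refine hX ⟨fun {Y} f _ => ⟨fun hf h0f => h0 ?_, fun h0f => h Y f inferInstance h0f⟩⟩
      subst h0f
      exact (IsZero.iff_id_eq_zero X).2 (by rw [← IsIso.inv_hom_id (0 : Y ⟶ X), comp_zero])
    have hS : (ShortComplex.mk f (cokernel.π f) (cokernel.condition f)).ShortExact :=
      { exact := ShortComplex.exact_cokernel f }
    have hY : ¬ IsZero Y := fun h => hf0 (h.eq_of_src _ _)
    have hZ : ¬ IsZero (cokernel f) := fun h => hf (by
      have : Epi f := Preadditive.epi_of_isZero_cokernel f h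
      exact isIso_of_mono_of_epi f)
    have hrank : Module.finrank k (P ⟶ cokernel f) + Module.finrank k (P ⟶ Y) =
        Module.finrank k (P ⟶ X) := by
      rw [← (Linear.rightComp k P (cokernel.π f)).finrank_range_add_finrank_ker,
        LinearMap.range_eq_top.2 fun z => ⟨Projective.factorThru z (cokernel.π f), by simp⟩,
        finrank_top]
      have hk : LinearMap.ker (Linear.rightComp k P (cokernel.π f)) =
          LinearMap.range (Linear.rightComp k P f) := by
        ext z
        constructor
        · intro hz
          exact ⟨Abelian.monoLift f z hz, Abelian.monoLift_comp f z hz⟩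
        · rintro ⟨y, rfl⟩
          simp
      rw [hk, LinearMap.finrank_range_of_inj fun x y h => (cancel_mono f).1 h]
    have h1 := hpos hY
    have h2 := hpos hZ
    have := grothendieckClass_shortExact hS
    dsimp only at this
    rw [this, TensorProduct.tmul_add]
    exact Submodule.add_mem _ (ih _ (by omega) Y rfl) (ih _ (by omega) (cokernel f) rfl)

theorem mem_span_grothendieckClass (k : Type w) [Field k] (x : LinearGrothendieckRing C k) :
    x ∈ Submodule.span k (Set.range fun X : C =>
      ((1 : k) ⊗ₜ[ℤ] grothendieckClass C X : LinearGrothendieckRing C k)) := by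
  induction x using TensorProduct.induction_on with
  | zero => exact Submodule.zero_mem _
  | add x y hx hy => exact Submodule.add_mem _ hx hy
  | tmul c r =>
    have hc : c ⊗ₜ[ℤ] r = c • ((1 : k) ⊗ₜ[ℤ] r) := by simp [TensorProduct.smul_tmul']
    rw [hc]
    clear hc
    refine Submodule.smul_mem _ c ?_
    obtain ⟨a, rfl⟩ := Ideal.Quotient.mk_surjective r
    induction a using MonoidAlgebra.induction_on with
    | of s =>
      obtain ⟨X, rfl⟩ : ∃ X : C, toSkeleton X = s := Quotient.exists_rep s
      exact Submodule.subset_span ⟨X, rfl⟩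
    | add f g hf hg =>
      rw [map_add, TensorProduct.tmul_add]
      exact Submodule.add_mem _ hf hg
    | smul n f hf =>
      rw [map_zsmul, TensorProduct.tmul_smul]
      exact zsmul_mem hf n

end Generation

/-! ### The action of the Grothendieck ring: its range and its faithfulness. -/

section Representation

variable (k : Type w) [Field k] (C : Type u) [Category.{v} C] [Abelian C] [Linear k C]
  [MonoidalCategory C] [MonoidalPreadditive C] [MonoidalLinear k C] [RigidCategory C]
  [BraidedCategory C] [RibbonCategory C] [HasCoend (innerHom C)]

/-- The defect operators, as a monoid homomorphism on isomorphism classes of objects. -/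
noncomputable def defectMonoidHom : Skeleton C →* moduleEnd C k where
  toFun s := ⟨defectOperator ((fromSkeleton C).obj s), defectOperator_mem_moduleEnd k _⟩
  map_one' := Subtype.ext ((defectOperator_congr (fromSkeletonToSkeletonIso (𝟙_ C))).trans
    defectOperator_unit)
  map_mul' _ _ := Subtype.ext ((defectOperator_congr (fromSkeletonToSkeletonIso _)).trans
    (defectOperator_tensor _ _))

theorem defectMonoidHom_toSkeleton (X : C) : defectMonoidHom k C (toSkeleton X) =
    ⟨defectOperator X, defectOperator_mem_moduleEnd k X⟩ :=
  Subtype.ext (defectOperator_congr (fromSkeletonToSkeletonIso X))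

/-- The action of the Grothendieck ring by defect operators. -/
noncomputable def grothendieckAction : GrothendieckRing C →+* moduleEnd C k :=
  Ideal.Quotient.lift _ (MonoidAlgebra.lift ℤ (moduleEnd C k) (Skeleton C)
    (defectMonoidHom k C)).toRingHom fun a ha => by
      change a ∈ AddSubgroup.closure (grothendieckRelations C) at ha
      induction ha using AddSubgroup.closure_induction with
      | mem r hr =>
        obtain ⟨S, hS, rfl⟩ := hr
        simp only [map_sub, AlgHom.toRingHom_eq_coe, RingHom.coe_coe, MonoidAlgebra.lift_of,
          defectMonoidHom_toSkeleton]
        refine Subtype.ext ?_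
        change defectOperator S.X₂ - defectOperator S.X₁ - defectOperator S.X₃ = 0
        rw [defectOperator_shortExact hS, sub_sub, sub_self]
      | zero => exact map_zero _
      | add x y _ _ hx hy => rw [map_add, hx, hy, add_zero]
      | neg x _ hx => rw [map_neg, hx, neg_zero]

theorem grothendieckAction_class (X : C) : grothendieckAction k C (grothendieckClass C X) =
    ⟨defectOperator X, defectOperator_mem_moduleEnd k X⟩ := by
  rw [← defectMonoidHom_toSkeleton]
  exact MonoidAlgebra.lift_of (defectMonoidHom k C) (toSkeleton X)

/-- The action of the linearised Grothendieck ring by defect operators. -/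
noncomputable def linearGrothendieckAction : LinearGrothendieckRing C k →ₐ[k] moduleEnd C k :=
  Algebra.TensorProduct.lift (Algebra.ofId k (moduleEnd C k))
    { grothendieckAction k C with
      commutes' := fun n => by
        change grothendieckAction k C (algebraMap ℤ _ n) = _
        rw [eq_intCast (algebraMap ℤ (GrothendieckRing C)), eq_intCast (algebraMap ℤ (moduleEnd C k)),
          map_intCast] }
    fun c _ => Algebra.commutes c _

theorem linearGrothendieckAction_class (X : C) :
    linearGrothendieckAction k C ((1 : k) ⊗ₜ[ℤ] grothendieckClass C X) =
      ⟨defectOperator X, defectOperator_mem_moduleEnd k X⟩ := by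
  rw [← grothendieckAction_class]
  refine (Algebra.TensorProduct.lift_tmul _ _ _ _ _).trans ?_
  rw [map_one, one_mul]
  rfl

theorem linearGrothendieckAction_range : (linearGrothendieckAction k C).range =
    Algebra.adjoin k (Set.range fun D : C =>
      (⟨defectOperator D, defectOperator_mem_moduleEnd k D⟩ : moduleEnd C k)) := by
  apply le_antisymm
  · rintro _ ⟨x, rfl⟩
    have hx := mem_span_grothendieckClass k x
    induction hx using Submodule.span_induction with
    | mem _ h =>
      obtain ⟨X, rfl⟩ := h
      exact Algebra.subset_adjoin ⟨X, (linearGrothendieckAction_class k C X).symm⟩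
    | zero => exact (map_zero (linearGrothendieckAction k C)).symm ▸ Subalgebra.zero_mem _
    | add x y _ _ hx hy =>
      exact (map_add (linearGrothendieckAction k C) x y).symm ▸ Subalgebra.add_mem _ hx hy
    | smul c x _ hx =>
      exact (map_smul (linearGrothendieckAction k C) c x).symm ▸ Subalgebra.smul_mem _ hx c
  · refine Algebra.adjoin_le ?_
    rintro _ ⟨D, rfl⟩
    exact ⟨_, linearGrothendieckAction_class k C D⟩

/-- An element of the kernel is a combination of classes of simples. Applying its vanishing action
to the unit cocharacter gives a relation between cocharacters of simples, which must be trivial.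
Independence of the classes of simples need not be known beforehand. -/
theorem linearGrothendieckAction_injective [IsAlgClosed k] [IsFiniteTensorCategory k C] :
    Function.Injective (linearGrothendieckAction k C) := by
  rw [injective_iff_map_eq_zero]
  intro x hx
  -- The skeleton provides one representative of each isomorphism class, so distinct indices give
  -- non-isomorphic simples.
  let T := {s : Skeleton C // Simple ((fromSkeleton C).obj s)}
  let v : T → LinearGrothendieckRing C k := fun s =>
    (1 : k) ⊗ₜ[ℤ] grothendieckClass C ((fromSkeleton C).obj s.1)
  have hspan : x ∈ Submodule.span k (Set.range v) := by
    refine Submodule.span_le.2 ?_ (mem_span_grothendieckClass k x)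
    rintro _ ⟨X, rfl⟩
    refine Submodule.span_mono ?_ (tmul_grothendieckClass_mem_span k X)
    rintro _ ⟨S, hS, rfl⟩
    refine ⟨⟨toSkeleton S, (Simple.iff_of_iso (fromSkeletonToSkeletonIso S)).2 hS⟩, ?_⟩
    simp only [v]
    rw [grothendieckClass_congr (fromSkeletonToSkeletonIso S)]
  obtain ⟨c, rfl⟩ := (Finsupp.mem_span_range_iff_exists_finsupp).1 hspan
  let S : c.support → C := fun s => (fromSkeleton C).obj s.1.1
  have : ∀ s, Simple (S s) := fun s => s.1.2
  have hS : ∀ s t, s ≠ t → IsEmpty (S s ≅ S t) := fun s t hst => ⟨fun e => hst (by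
    refine Subtype.ext (Subtype.ext ?_)
    exact skeleton_skeletal C ⟨(fromSkeleton C).preimageIso e⟩)⟩
  have hsum : ∑ s : c.support, c s • cocharacter (S s) = 0 := by
    have h : ∑ s : c.support, c s • defectOperator (S s) = 0 := by
      have h1 := congrArg Subtype.val hx
      rw [Finsupp.sum, map_sum, ← Finset.sum_coe_sort] at h1
      simp only [map_smul, v, linearGrothendieckAction_class] at h1
      simpa using h1
    have h2 := congrArg (fun f : canonicalCoend C ⟶ canonicalCoend C => cocharacter (𝟙_ C) ≫ f) h
    refine Eq.trans ?_ (h2.trans comp_zero)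
    change _ = cocharacter (𝟙_ C) ≫ (∑ s : c.support, c s •
      (show canonicalCoend C ⟶ canonicalCoend C from defectOperator (S s)))
    rw [Preadditive.comp_sum]
    refine Finset.sum_congr rfl fun s _ => ?_
    rw [Linear.comp_smul, cocharacter_comp_defectOperator]
  have hc := eq_zero_of_sum_cocharacter_eq_zero k S hS (fun s => c s) hsum
  have : c = 0 := by
    ext s
    by_contra h
    exact h (hc ⟨s, Finsupp.mem_support_iff.2 h⟩)
  rw [this, Finsupp.sum_zero_index]

theorem exists_algEquiv_linearGrothendieckRing [IsAlgClosed k] [IsFiniteTensorCategory k C] :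
    ∃ h : ∀ D : C, defectOperator D ∈ moduleEnd C k,
      ∃ Φ : Algebra.adjoin k (Set.range fun D : C =>
          (⟨defectOperator D, h D⟩ : moduleEnd C k)) ≃ₐ[k] LinearGrothendieckRing C k,
        ∀ D : C, Φ ⟨⟨defectOperator D, h D⟩, Algebra.subset_adjoin ⟨D, rfl⟩⟩ =
          TensorProduct.tmul ℤ (1 : k) (grothendieckClass C D) := by
  let Ψ := (AlgEquiv.ofInjective _ (linearGrothendieckAction_injective k C)).trans
    (Subalgebra.equivOfEq _ _ (linearGrothendieckAction_range k C))
  refine ⟨defectOperator_mem_moduleEnd k, Ψ.symm, fun D => ?_⟩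
  rw [AlgEquiv.symm_apply_eq]
  exact Subtype.ext (linearGrothendieckAction_class k C D).symm

end Representation

end ModularTensor

open ModularTensor
theorem proposition5p1 (k : Type w) [Field k] [IsAlgClosed k] [CharZero k]
    (C : Type u) [Category.{v} C] [Abelian C] [Linear k C] [MonoidalCategory C]
    [MonoidalPreadditive C] [MonoidalLinear k C] [RigidCategory C] [BraidedCategory C]
    [RibbonCategory C] [IsModularTensorCategory k C] :
    haveI : HasCoend (innerHom C) := hasCoend_innerHom k C
    ∃ h : ∀ D : C, defectOperator D ∈ moduleEnd C k,
      ∃ Φ : Algebra.adjoin k (Set.range fun D : C =>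
          (⟨defectOperator D, h D⟩ : moduleEnd C k)) ≃ₐ[k] LinearGrothendieckRing C k,
        ∀ D : C, Φ ⟨⟨defectOperator D, h D⟩, Algebra.subset_adjoin ⟨D, rfl⟩⟩ =
          TensorProduct.tmul ℤ (1 : k) (grothendieckClass C D) := by
  have : HasCoend (innerHom C) := hasCoend_innerHom k C
  exact exists_algEquiv_linearGrothendieckRing k C
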